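/- **Definitions.** A signature is a finite set of relation symbols, each with a positive arity; a fact over it is $R(t)$ with $R$ a relation symbol and $t$ a tuple of constants of length the arity of $R$; an instance is a finite set of facts. An *inconsistent prioritizing instance* over a signature is a triple $D=(I,\mathcal H,\succ)$, where $I$ is an instance, $\mathcal H$ is a conflict hypergraph, that is, a hypergraph whose nodes are the facts of $I$ (its hyperedges are arbitrary subsets of $I$), and $\succ$ is an acyclic binary relation on $I$ such that $f\succ g$ implies that $f$ and $g$ are neighbors, i.e., distinct facts that occur together in some hyperedge. A set $J\subseteq I$ is *consistent* if it contains no hyperedge of $\mathcal H$. For distinct consistent $J,J'\subseteq I$, $J$ is a *global improvement* of $J'$ if for every $f'\in J'\setminus J$ there is $f\in J\setminus J'$ with $f\succ f'$; a consistent $J$ without a global improvement is *globally optimal*. A *completion* of $D$ is an inconsistent prioritizing instance $(I,\mathcal H,\succ_c)$ such that $\succ_c$ contains $\succ$ and, for any two neighbors $f,g$, $f\succ_c g$ or $g\succ_c f$. A consistent $J\subseteq I$ is a *completion-optimal repair* (c-repair) of $D$ if it is globally optimal for some completion of $D$. *c-categoricity* is the following decision problem: given a signature and an inconsistent prioritizing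 instance $D=(I,\mathcal H,\succ)$ over it (with the facts and the hyperedges listed explicitly, in any order), does $D$ have exactly one c-repair? For a fixed signature $S$ and a fixed set $\Delta$ of functional dependencies over $S$, *c-categoricity$\langle S,\Delta\rangle$* is the problem in which the input is only $(I,\succ)$, and $\mathcal H$ is the conflict graph that has an edge between every two facts of $I$ that violate a dependency of $\Delta$. **Theorem.** The c-categoricity problem is solvable in (deterministic) polynomial time. Moreover, for every signature $S$ and every set $\Delta$ of functional dependencies over $S$, c-categoricity$\langle S,\Delta\rangle$ is solvable in polynomial time. -/

import Mathlib

/-- An inconsistent prioritizing instance `(I, H, ≻)` over a type `F` of facts: a finite set `I` of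
facts, a conflict hypergraph `H` on `I`, given by its set of hyperedges, and an acyclic priority
relation `≻` that relates only facts occurring together in some hyperedge (hence facts of `I`). -/
structure PrioritizingInstance (F : Type) where
  facts : Finset F
  edges : Set (Finset F)
  edges_subset : ∀ e ∈ edges, e ⊆ facts
  /-- `prior f g` means `f ≻ g`, that is, `f` is preferred to `g`. -/
  prior : F → F → Prop
  acyclic : ∀ f, ¬ Relation.TransGen prior f f
  prior_neighbors : ∀ f g, prior f g → ∃ e ∈ edges, f ∈ e ∧ g ∈ e

namespace PrioritizingInstance

variable {F : Type}

/-- Two facts are neighbors if they are distinct and occur together in some hyperedge. -/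
def Neighbors (D : PrioritizingInstance F) (f g : F) : Prop :=
  f ≠ g ∧ ∃ e ∈ D.edges, f ∈ e ∧ g ∈ e

/-- `J` is a consistent subinstance: a set of facts of `I` that contains no hyperedge. -/
def Consistent (D : PrioritizingInstance F) (J : Finset F) : Prop :=
  J ⊆ D.facts ∧ ∀ e ∈ D.edges, ¬ e ⊆ J

/-- `J` is a global improvement of `J'`: both are consistent subinstances, they are distinct, and
every fact of `J'` outside `J` is less preferred than some fact of `J` outside `J'`. -/
def GlobalImprovement (D : PrioritizingInstance F) (J J' : Finset F) : Prop :=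
  D.Consistent J ∧ D.Consistent J' ∧ J ≠ J' ∧
    ∀ f' ∈ J', f' ∉ J → ∃ f ∈ J, f ∉ J' ∧ D.prior f f'

/-- Globally-optimal repairs. -/
def GloballyOptimal (D : PrioritizingInstance F) (J : Finset F) : Prop :=
  D.Consistent J ∧ ¬ ∃ K, D.GlobalImprovement K J

/-- The priority is total: it orders every two neighbors. -/
def IsTotal (D : PrioritizingInstance F) : Prop :=
  ∀ f g, D.Neighbors f g → D.prior f g ∨ D.prior g f

/-- `E` is a completion of `D`: a prioritizing instance with the same facts and the same conflict
hypergraph, whose priority is total and extends that of `D`. -/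
def IsCompletion (D E : PrioritizingInstance F) : Prop :=
  E.facts = D.facts ∧ E.edges = D.edges ∧ (∀ f g, D.prior f g → E.prior f g) ∧ E.IsTotal

/-- Completion-optimal repairs. -/
def CompletionOptimal (D : PrioritizingInstance F) (J : Finset F) : Prop :=
  D.Consistent J ∧ ∃ E, D.IsCompletion E ∧ E.GloballyOptimal J

/-- There is exactly one completion-optimal repair. -/
def CCategorical (D : PrioritizingInstance F) : Prop :=
  ∃! J, D.CompletionOptimal J

end PrioritizingInstance

/-- A relational signature: finitely many relation symbols, each with a positive arity. -/
structure RelSignature where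
  numRel : ℕ
  arity : Fin numRel → ℕ
  arity_pos : ∀ R, 0 < arity R

/-- Constants (database values) are finite binary words. -/
abbrev DBConst : Type := List Bool

/-- A fact `R(t)` over a signature: a relation symbol and a tuple of constants. -/
abbrev DBFact (S : RelSignature) : Type :=
  (R : Fin S.numRel) × (Fin (S.arity R) → DBConst)

/-- A functional dependency `R : X → Y`. -/
structure FD (S : RelSignature) where
  rel : Fin S.numRel
  lhs : Finset (Fin (S.arity rel))
  rhs : Finset (Fin (S.arity rel))

/-- The instance `J` satisfies the functional dependency: any two of its facts over the relation
symbol that agree on the left-hand side also agree on the right-hand side. -/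
def FD.Satisfied {S : RelSignature} (d : FD S) (J : Finset (DBFact S)) : Prop :=
  ∀ s t : Fin (S.arity d.rel) → DBConst,
    (⟨d.rel, s⟩ : DBFact S) ∈ J → (⟨d.rel, t⟩ : DBFact S) ∈ J →
      (∀ i ∈ d.lhs, s i = t i) → ∀ i ∈ d.rhs, s i = t i

/-- The conflict graph of the instance `I` for a set of functional dependencies: an edge between
every two facts that violate one of the dependencies. -/
def fdConflictEdges {S : RelSignature} (Δ : Set (FD S)) (I : Finset (DBFact S)) :
    Set (Finset (DBFact S)) :=
  {e | ∃ f ∈ I, ∃ g ∈ I, e = {f, g} ∧ ∃ d ∈ Δ, ¬ d.Satisfied {f, g}}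

open Computability in
/-- A binary word, written with the bit symbols of the input alphabet. -/
def encBits (w : List Bool) : List Γ' :=
  w.map Γ'.bit

open Computability in
/-- A row of bits between brackets. -/
def encRow (w : List Bool) : List Γ' :=
  Γ'.bra :: encBits w ++ [Γ'.ket]

open Computability in
/-- A signature is written as the list of its arities, in binary. -/
def encSignature (S : RelSignature) : List Γ' :=
  (List.ofFn S.arity).flatMap fun a => encRow (encodeNat a)

open Computability in
/-- A fact is written as the number of its relation symbol, in binary, followed by its constants. -/
def encFact {S : RelSignature} (f : DBFact S) : List Γ' :=
  Γ'.bra :: encBits (encodeNat f.1) ++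
    ((List.ofFn f.2).flatMap fun c => Γ'.comma :: encBits c) ++ [Γ'.ket]

open Computability Classical in
/-- A set of hyperedges over listed facts is written as its incidence matrix, one row for each
listed hyperedge. -/
noncomputable def encEdges {F : Type} (fs : List F) (es : List (Finset F)) : List Γ' :=
  es.flatMap fun e => encRow (fs.map fun f => decide (f ∈ e))

open Computability Classical in
/-- A binary relation on listed facts is written as its adjacency matrix, row by row. -/
noncomputable def encRelation {F : Type} (fs : List F) (r : F → F → Prop) : List Γ' :=
  fs.flatMap fun f => encRow (fs.map fun g => decide (r f g))

/-- An input of c-categoricity: a signature and an inconsistent prioritizing instance over it,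
presented by listing its facts (without repetition) and its hyperedges in any order. -/
structure CCatInput where
  sig : RelSignature
  inst : PrioritizingInstance (DBFact sig)
  factList : List (DBFact sig)
  factList_nodup : factList.Nodup
  mem_factList : ∀ f, f ∈ factList ↔ f ∈ inst.facts
  edgeList : List (Finset (DBFact sig))
  mem_edgeList : ∀ e, e ∈ edgeList ↔ e ∈ inst.edges

open Computability in
/-- The input as a word: signature, facts, conflict hypergraph, priority relation. -/
noncomputable def CCatInput.encode (x : CCatInput) : List Γ' :=
  encSignature x.sig ++ Γ'.blank :: x.factList.flatMap encFact ++
    Γ'.blank :: encEdges x.factList x.edgeList ++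
    Γ'.blank :: encRelation x.factList x.inst.prior

open Classical in
/-- The c-categoricity problem. -/
noncomputable def CCatInput.answer (x : CCatInput) : Bool :=
  decide x.inst.CCategorical

/-- An input of c-categoricity for a fixed schema `(S, Δ)`: an instance over `S`, presented by
listing its facts in any order, and a priority relation over it; the conflict hypergraph is the one
that `Δ` induces, and it is not a part of the encoded input. -/
structure FDCCatInput (S : RelSignature) (Δ : Set (FD S)) where
  inst : PrioritizingInstance (DBFact S)
  edges_eq : inst.edges = fdConflictEdges Δ inst.facts
  factList : List (DBFact S)
  factList_nodup : factList.Nodup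
  mem_factList : ∀ f, f ∈ factList ↔ f ∈ inst.facts

open Computability in
/-- The input as a word: facts, priority relation. -/
noncomputable def FDCCatInput.encode {S : RelSignature} {Δ : Set (FD S)} (x : FDCCatInput S Δ) :
    List Γ' :=
  x.factList.flatMap encFact ++ Γ'.blank :: encRelation x.factList x.inst.prior

open Classical in
/-- The c-categoricity problem for a fixed schema. -/
noncomputable def FDCCatInput.answer {S : RelSignature} {Δ : Set (FD S)} (x : FDCCatInput S Δ) :
    Bool :=
  decide x.inst.CCategorical

/-- A total decision problem, given by an encoding of its inputs over the alphabet `Γ` and by their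
answers, is solvable in (deterministic) polynomial time: some Turing machine computes the answer to
every input in at most `p(n)` steps, for a polynomial `p` in the length `n` of the encoded input. -/
def SolvableInPolyTime {α Γ : Type} (encode : α → List Γ) (answer : α → Bool) : Prop :=
  Nonempty (Turing.TM2ComputableInPolyTime encode Computability.encodeBool answer)

/-! Say that `J` blocks a fact `f` if some hyperedge consists of `f` and members of `J` that lie
above `f` in the transitive closure of `≻`. Whether `J` blocks `f` depends only on the part of `J`
strictly above `f`, so recursion along `≻` yields exactly one set `J ⊆ I` that consists of the facts
of `I` it does not block. The heart of the proof is `IsFixpoint.cCategorical_iff`: there is exactly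
one c-repair iff this `J` is consistent.

If `J` is consistent, let `K` be another consistent set and `f ∈ K \ J`. Then `J` blocks `f` through
a hyperedge `e`; since `e ⊄ K`, some `g ∈ e` is in `J \ K`. It lies above `f` and is a neighbor of
`f`, so every completion prefers `g` to `f`. Hence `J` improves every other consistent set in every
completion. Conversely, let `K` be the only c-repair. Being consistent, it blocks none of its
members. If it did not block some `f ∉ K`, take a completion in which only facts above `f` are
preferred to `f` (`exists_completion`). It has an optimal repair, which must be `K`, and optimality
against inserting `f` yields a hyperedge that blocks `f` (`GloballyOptimal.exists_edge`). So `K =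
J`.

The fixpoint is reached after `|I|` rounds from any starting set, so a transitive closure, an
iteration and an inclusion test decide the problem. To bound the time on a Turing machine,
structured stack programs with step counts are compiled to `TM2` machines, data are represented by
binary trees, and the functions computable in polynomial time are shown to be closed under
composition, pairing and folds with polynomially bounded accumulators. Parser and decision procedure
are assembled from these. For a fixed `Δ`, which is necessarily finite, the conflict graph is
computed first. -/

section

/-! ### The survival fixpoint and the characterization of c-categoricity -/

namespace PrioritizingInstance

variable {F : Type}

theorem mem_facts_of_prior (D : PrioritizingInstance F) {f g : F} (h : D.prior f g) :
    f ∈ D.facts ∧ g ∈ D.facts := by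
  obtain ⟨e, he, hf, hg⟩ := D.prior_neighbors f g h
  exact ⟨D.edges_subset e he hf, D.edges_subset e he hg⟩

theorem mem_facts_of_transGen (D : PrioritizingInstance F) {f g : F}
    (h : Relation.TransGen D.prior f g) : f ∈ D.facts := by
  obtain ⟨c, hc, -⟩ := Relation.TransGen.head'_iff.1 h
  exact (D.mem_facts_of_prior hc).1

open Classical in
/-- The number of facts preferred to `f`, directly or through a chain of preferences. -/
noncomputable def rank (D : PrioritizingInstance F) (f : F) : ℕ :=
  (D.facts.filter fun g => Relation.TransGen D.prior g f).card

/-- Everything above `f` is above `g`, and by acyclicity `f` itself is above `g` but not above `f`.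
Rank is the induction measure throughout. -/
theorem rank_lt_rank (D : PrioritizingInstance F) {f g : F} (h : Relation.TransGen D.prior f g) :
    D.rank f < D.rank g := by
  classical
  refine Finset.card_lt_card (Finset.ssubset_iff_of_subset ?_ |>.2 ⟨f, ?_, ?_⟩)
  · intro x hx
    simp only [Finset.mem_filter] at hx ⊢
    exact ⟨hx.1, hx.2.trans h⟩
  · simp only [Finset.mem_filter]
    exact ⟨D.mem_facts_of_transGen h, h⟩
  · simp [D.acyclic f]

theorem rank_lt_card (D : PrioritizingInstance F) {f : F} (hf : f ∈ D.facts) :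
    D.rank f < D.facts.card := by
  classical
  refine Finset.card_lt_card (Finset.ssubset_iff_of_subset (Finset.filter_subset _ _) |>.2
    ⟨f, hf, ?_⟩)
  simp [D.acyclic f]

/-- `f` survives with respect to `J`: no hyperedge consists of `f` and of members of `J` that are
preferred to `f` through chains of preferences. -/
def Survives (D : PrioritizingInstance F) (J : F → Prop) (f : F) : Prop :=
  ¬ ∃ e ∈ D.edges, f ∈ e ∧ ∀ g ∈ e, g ≠ f → J g ∧ Relation.TransGen D.prior g f

/-- This locality is what makes recursion along the priority possible. -/
theorem survives_congr (D : PrioritizingInstance F) {J K : F → Prop} {f : F}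
    (h : ∀ g, Relation.TransGen D.prior g f → (J g ↔ K g)) : D.Survives J f ↔ D.Survives K f := by
  unfold Survives
  refine not_congr (exists_congr fun e => and_congr_right fun _ => and_congr_right fun _ =>
    forall_congr' fun g => imp_congr_right fun _ => imp_congr_right fun _ => ?_)
  constructor
  · rintro ⟨h1, h2⟩
    exact ⟨(h g h2).1 h1, h2⟩
  · rintro ⟨h1, h2⟩
    exact ⟨(h g h2).2 h1, h2⟩

/-- A fact is settled one round after all facts above it, and these have smaller rank; the starting
set is irrelevant. -/
theorem iterate_survives_stable (D : PrioritizingInstance F) (J : F → Prop) (k : ℕ) :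
    ∀ f, D.rank f < k → (D.Survives^[k + 1] J f ↔ D.Survives^[k] J f) := by
  induction k with
  | zero => intro f hf; omega
  | succ k ih =>
    intro f hf
    rw [Function.iterate_succ_apply', Function.iterate_succ_apply' (n := k)]
    refine D.survives_congr fun g hg => ?_
    have := D.rank_lt_rank hg
    simpa only [Function.iterate_succ_apply'] using ih g (by omega)

/-- `J` consists of the facts that survive with respect to `J`. -/
def IsFixpoint (D : PrioritizingInstance F) (J : Finset F) : Prop :=
  J ⊆ D.facts ∧ ∀ f ∈ D.facts, f ∈ J ↔ D.Survives (· ∈ J) f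

open Classical in
theorem isFixpoint_iterate (D : PrioritizingInstance F) (J : F → Prop) :
    D.IsFixpoint (D.facts.filter (D.Survives^[D.facts.card] J)) := by
  refine ⟨Finset.filter_subset _ _, fun f hf => ?_⟩
  rw [Finset.mem_filter, ← D.iterate_survives_stable J _ f (D.rank_lt_card hf),
    Function.iterate_succ_apply']
  simp only [hf, true_and]
  refine D.survives_congr fun g hg => ?_
  simp [D.mem_facts_of_transGen hg]

/-- Induction on rank: two fixpoints that agree above `f` agree at `f`. -/
theorem IsFixpoint.eq {D : PrioritizingInstance F} {J K : Finset F} (hJ : D.IsFixpoint J)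
    (hK : D.IsFixpoint K) : J = K := by
  have key : ∀ n, ∀ f ∈ D.facts, D.rank f < n → (f ∈ J ↔ f ∈ K) := by
    intro n
    induction n with
    | zero => intro f _ hf; omega
    | succ n ih =>
      intro f hf hn
      rw [hJ.2 f hf, hK.2 f hf]
      refine D.survives_congr fun g hg => ih g (D.mem_facts_of_transGen hg) ?_
      have := D.rank_lt_rank hg
      omega
  ext f
  by_cases hf : f ∈ D.facts
  · exact key _ f hf (Nat.lt_succ_self _)
  · exact ⟨fun h => (hf (hJ.1 h)).elim, fun h => (hf (hK.1 h)).elim⟩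

theorem IsCompletion.transGen_mono {D E : PrioritizingInstance F} (h : D.IsCompletion E) {f g : F}
    (hfg : Relation.TransGen D.prior f g) : Relation.TransGen E.prior f g :=
  Relation.TransGen.mono h.2.2.1 _ _ hfg

/-- The hyperedge that blocks `f ∈ K \ J` is not contained in `K`, so one of its other members is in
`J \ K`. That member is above `f` in `D`, and acyclicity forces any completion to orient the pair
the same way. -/
theorem IsFixpoint.globalImprovement {D E : PrioritizingInstance F} {J K : Finset F}
    (hJ : D.IsFixpoint J) (hc : D.Consistent J) (hE : D.IsCompletion E) (hK : E.Consistent K)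
    (hne : J ≠ K) : E.GlobalImprovement J K := by
  refine ⟨⟨hE.1 ▸ hc.1, hE.2.1 ▸ hc.2⟩, hK, hne, fun f hf hfJ => ?_⟩
  have hfD : f ∈ D.facts := hE.1 ▸ hK.1 hf
  have := (not_congr (hJ.2 f hfD)).1 hfJ
  unfold Survives at this
  push Not at this
  obtain ⟨e, he, hfe, hall⟩ := this
  have hnot := hK.2 e (hE.2.1.symm ▸ he)
  obtain ⟨g, hge, hgK⟩ := Finset.not_subset.1 hnot
  have hgf : g ≠ f := fun h => hgK (h ▸ hf)
  obtain ⟨hgJ, hgt⟩ := hall g hge hgf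
  refine ⟨g, hgJ, hgK, ?_⟩
  have hgt := hE.transGen_mono hgt
  rcases hE.2.2.2 g f ⟨hgf, e, hE.2.1.symm ▸ he, hge, hfe⟩ with h | h
  · exact h
  · exact (E.acyclic g (hgt.tail h)).elim

/-- Two distinct sets cannot improve each other: below any fact on which they differ in rank there
would be another one, found by applying one of the two improvements. -/
theorem globallyOptimal_of_improves (E : PrioritizingInstance F) {J : Finset F}
    (hc : E.Consistent J) (h : ∀ K, E.Consistent K → J ≠ K → E.GlobalImprovement J K) :
    E.GloballyOptimal J := by
  refine ⟨hc, ?_⟩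
  rintro ⟨K, hK⟩
  have hJK := h K hK.1 hK.2.2.1.symm
  have step : ∀ n, ∀ f, E.rank f < n → (f ∈ J ↔ f ∈ K) := by
    intro n
    induction n with
    | zero => intro f hf; omega
    | succ n ih =>
      intro f hf
      have hlt : ∀ {g}, E.prior g f → E.rank g < n := fun hg => by
        have := E.rank_lt_rank (Relation.TransGen.single hg)
        omega
      constructor
      · intro hfJ
        by_contra hfK
        obtain ⟨g, hgK, hgJ, hg⟩ := hK.2.2.2 f hfJ hfK
        exact hgJ ((ih g (hlt hg)).2 hgK)
      · intro hfK
        by_contra hfJ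
        obtain ⟨g, hgJ, hgK, hg⟩ := hJK.2.2.2 f hfK hfJ
        exact hgK ((ih g (hlt hg)).1 hgJ)
  exact hK.2.2.1 (Finset.ext fun f => (step _ f (Nat.lt_succ_self _)).symm)

theorem IsFixpoint.globallyOptimal {D E : PrioritizingInstance F} {J : Finset F}
    (hJ : D.IsFixpoint J) (hc : D.Consistent J) (hE : D.IsCompletion E) : E.GloballyOptimal J :=
  E.globallyOptimal_of_improves ⟨hE.1 ▸ hc.1, hE.2.1 ▸ hc.2⟩
    fun _ hK hne => hJ.globalImprovement hc hE hK hne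

/-- There is a completion in which only facts preferred to `f` through chains of preferences are
preferred to `f`. -/
theorem exists_completion (D : PrioritizingInstance F) (f : F) :
    ∃ E, D.IsCompletion E ∧ ∀ g, E.prior g f → Relation.TransGen D.prior g f := by
  let A : F → Prop := fun a => a = f ∨ Relation.TransGen D.prior a f
  have hA : ∀ {a b}, Relation.TransGen D.prior a b → A b → A a := by
    rintro a b h (rfl | hb)
    · exact Or.inr h
    · exact Or.inr (h.trans hb)
  -- Besides the given priority, all of `A`, that is, `f` and the facts above it, is placed before
  -- everything else. As `A` is closed under going up, this is a partial order; a linear extension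
  -- restricted to neighbors is the completion.
  let r : F → F → Prop := fun a b => a = b ∨ Relation.TransGen D.prior a b ∨ (A a ∧ ¬ A b)
  have : IsPartialOrder F r :=
    { refl := fun a => Or.inl rfl
      trans := by
        rintro a b c (rfl | h | ⟨h, h'⟩) (rfl | k | ⟨k, k'⟩)
        · exact Or.inl rfl
        · exact Or.inr (Or.inl k)
        · exact Or.inr (Or.inr ⟨k, k'⟩)
        · exact Or.inr (Or.inl h)
        · exact Or.inr (Or.inl (h.trans k))
        · exact Or.inr (Or.inr ⟨hA h k, k'⟩)
        · exact Or.inr (Or.inr ⟨h, h'⟩)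
        · exact Or.inr (Or.inr ⟨h, fun hc => h' (hA k hc)⟩)
        · exact (h' k).elim
      antisymm := by
        rintro a b (rfl | h | ⟨h, h'⟩) (h1 | k | ⟨k, k'⟩)
        all_goals first
          | rfl
          | exact h1.symm
          | skip
        · exact (D.acyclic a (h.trans k)).elim
        · exact (k' (hA h k)).elim
        · exact (h' (hA k h)).elim
        · exact (h' k).elim }
  obtain ⟨s, hs, hrs⟩ := extend_partialOrder r
  have strict : ∀ {a b}, Relation.TransGen (fun a b => D.Neighbors a b ∧ s a b) a b →
      s a b ∧ a ≠ b := by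
    intro a b h
    induction h with
    | single h => exact ⟨h.2, h.1.1⟩
    | tail _ h ih =>
      refine ⟨hs.trans _ _ _ ih.1 h.2, ?_⟩
      rintro rfl
      exact ih.2 (hs.antisymm _ _ ih.1 h.2)
  refine ⟨{ facts := D.facts, edges := D.edges, edges_subset := D.edges_subset
            prior := fun a b => D.Neighbors a b ∧ s a b
            acyclic := fun a h => (strict h).2 rfl
            prior_neighbors := fun a b h => h.1.2 }, ⟨rfl, rfl, ?_, ?_⟩, ?_⟩
  · intro a b h
    refine ⟨⟨?_, D.prior_neighbors a b h⟩, hrs _ _ (Or.inr (Or.inl (.single h)))⟩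
    rintro rfl
    exact D.acyclic a (.single h)
  · intro a b h
    have h' : D.Neighbors a b := h
    rcases hs.total a b with h1 | h1
    · exact Or.inl ⟨h', h1⟩
    · exact Or.inr ⟨⟨h'.1.symm, h'.2.imp fun e he => ⟨he.1, he.2.2, he.2.1⟩⟩, h1⟩
  · rintro g ⟨hn, hg⟩
    by_contra hgf
    have hAg : ¬ A g := by
      rintro (h | h)
      · exact hn.1 h
      · exact hgf h
    exact hn.1 (hs.antisymm _ _ hg (hrs _ _ (Or.inr (Or.inr ⟨Or.inl rfl, hAg⟩))))

/-- In a hyperedge inside `J`, totality puts all other members above one of maximal rank, so that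
one would be blocked. -/
theorem IsTotal.consistent_of_isFixpoint {E : PrioritizingInstance F} (hE : E.IsTotal)
    (h0 : ∅ ∉ E.edges) {J : Finset F} (hJ : E.IsFixpoint J) : E.Consistent J := by
  refine ⟨hJ.1, fun e he hsub => ?_⟩
  have hne : e.Nonempty := by
    rw [Finset.nonempty_iff_ne_empty]
    rintro rfl
    exact h0 he
  obtain ⟨f, hf, hmax⟩ := e.exists_max_image E.rank hne
  refine (hJ.2 f (hJ.1 (hsub hf))).1 (hsub hf) ⟨e, he, hf, fun g hg hgf => ⟨hsub hg, ?_⟩⟩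
  rcases hE g f ⟨hgf, e, he, hg, hf⟩ with h | h
  · exact .single h
  · have := E.rank_lt_rank (.single h)
    have := hmax g hg
    omega

/-- The fixpoint of `E` is consistent, and `E` is a completion of itself. -/
theorem IsTotal.exists_globallyOptimal {E : PrioritizingInstance F} (hE : E.IsTotal)
    (h0 : ∅ ∉ E.edges) : ∃ J, E.GloballyOptimal J := by
  classical
  have hJ := E.isFixpoint_iterate fun _ => True
  exact ⟨_, hJ.globallyOptimal (hE.consistent_of_isFixpoint h0 hJ)
    ⟨rfl, rfl, fun _ _ h => h, hE⟩⟩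

/-- Inserting `f` into `K` and removing the facts below `f` would be an improvement, so the result
contains a hyperedge. It must contain `f`, and its other members, not being below `f`, are above it
by totality. -/
theorem GloballyOptimal.exists_edge {E : PrioritizingInstance F} (hE : E.IsTotal) {K : Finset F}
    (hK : E.GloballyOptimal K) {f : F} (hf : f ∈ E.facts) (hfK : f ∉ K) :
    ∃ e ∈ E.edges, f ∈ e ∧ ∀ g ∈ e, g ≠ f → g ∈ K ∧ E.prior g f := by
  classical
  let K' : Finset F := insert f (K.filter fun g => ¬ E.prior f g)
  have hnc : ¬ E.Consistent K' := by
    intro hc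
    refine hK.2 ⟨K', hc, hK.1, ?_, ?_⟩
    · intro h
      exact hfK (h ▸ Finset.mem_insert_self _ _)
    · intro g hg hgK'
      refine ⟨f, Finset.mem_insert_self _ _, hfK, ?_⟩
      by_contra hp
      exact hgK' (Finset.mem_insert_of_mem (Finset.mem_filter.2 ⟨hg, hp⟩))
  have hsub : K' ⊆ E.facts :=
    Finset.insert_subset hf ((Finset.filter_subset _ _).trans hK.1.1)
  unfold Consistent at hnc
  push Not at hnc
  obtain ⟨e, he, heK⟩ := hnc hsub
  have hmem : ∀ g ∈ e, g ≠ f → g ∈ K ∧ ¬ E.prior f g := by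
    intro g hg hgf
    exact Finset.mem_filter.1 ((Finset.mem_insert.1 (heK hg)).resolve_left hgf)
  have hfe : f ∈ e := by
    by_contra hfe
    refine hK.1.2 e he fun g hg => (hmem g hg ?_).1
    rintro rfl
    exact hfe hg
  refine ⟨e, he, hfe, fun g hg hgf => ⟨(hmem g hg hgf).1, ?_⟩⟩
  exact (hE g f ⟨hgf, e, he, hg, hfe⟩).resolve_right (hmem g hg hgf).2

/-- The reduction of the quantification over completions to one set. If `∅` is a hyperedge, nothing
is consistent and both sides fail. -/
theorem IsFixpoint.cCategorical_iff {D : PrioritizingInstance F} {J : Finset F}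
    (hJ : D.IsFixpoint J) : D.CCategorical ↔ D.Consistent J := by
  constructor
  · rintro ⟨K, ⟨hK, -⟩, huniq⟩
    have h0 : ∅ ∉ D.edges := fun h => hK.2 ∅ h (Finset.empty_subset _)
    suffices h : D.IsFixpoint K by rwa [hJ.eq h]
    refine ⟨hK.1, fun f hf => ⟨?_, ?_⟩⟩
    · rintro hfK ⟨e, he, hfe, hall⟩
      refine hK.2 e he fun g hg => ?_
      by_cases hgf : g = f
      · exact hgf ▸ hfK
      · exact (hall g hg hgf).1
    · intro hs
      by_contra hfK
      obtain ⟨E, hE, hEf⟩ := D.exists_completion f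
      obtain ⟨L, hL⟩ := hE.2.2.2.exists_globallyOptimal (hE.2.1.symm ▸ h0)
      have hLK : L = K := huniq L ⟨⟨hE.1 ▸ hL.1.1, hE.2.1 ▸ hL.1.2⟩, E, hE, hL⟩
      subst hLK
      obtain ⟨e, he, hfe, hall⟩ := hL.exists_edge hE.2.2.2 (hE.1.symm ▸ hf) hfK
      exact hs ⟨e, hE.2.1 ▸ he, hfe, fun g hg hgf =>
        ⟨(hall g hg hgf).1, hEf g (hall g hg hgf).2⟩⟩
  · intro hc
    refine ⟨J, ⟨hc, ?_⟩, ?_⟩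
    -- `exists_completion` needs a base fact; over an empty type of facts `D` is its own completion.
    · by_cases hF : Nonempty F
      · obtain ⟨E, hE, -⟩ := D.exists_completion hF.some
        exact ⟨E, hE, hJ.globallyOptimal hc hE⟩
      · have hD : D.IsCompletion D :=
          ⟨rfl, rfl, fun _ _ h => h, fun f => (hF ⟨f⟩).elim⟩
        exact ⟨D, hD, hJ.globallyOptimal hc hD⟩
    · rintro K ⟨hK, E, hE, hopt⟩
      by_contra hne
      exact hopt.2 ⟨J, hJ.globalImprovement hc hE hopt.1 (Ne.symm hne)⟩

end PrioritizingInstance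

end

/-! ### Structured stack programs and their compilation to Turing machines -/

section

/-- Programs over stacks indexed by `K` with alphabet `A`: pushing a symbol, popping a symbol and
branching on it, sequencing, and looping until a stack is empty, popping one symbol per round. -/
inductive Prog (K A : Type) : Type
  | skip : Prog K A
  | push (k : K) (a : A) : Prog K A
  | pop (k : K) (p : Option A → Prog K A) : Prog K A
  | seq (p q : Prog K A) : Prog K A
  | loop (k : K) (p : A → Prog K A) : Prog K A

namespace Prog

open Function

variable {K A : Type}

/-- `Runs p s t s'`: started on the stacks `s`, the program `p` halts after `t` steps with the
stacks `s'`. -/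
inductive Runs [DecidableEq K] : Prog K A → (K → List A) → ℕ → (K → List A) → Prop
  | skip (s) : Runs skip s 1 s
  | push (k a s) : Runs (push k a) s 1 (update s k (a :: s k))
  | pop {k p s t s'} : Runs (p (s k).head?) (update s k (s k).tail) t s' →
      Runs (pop k p) s (t + 1) s'
  | seq {p q s t s' t' s''} : Runs p s t s' → Runs q s' t' s'' → Runs (seq p q) s (t + t') s''
  | loop_nil {k p s} : s k = [] → Runs (loop k p) s 1 s
  | loop_cons {k p s a l t s' t' s''} : s k = a :: l → Runs (p a) (update s k l) t s' →
      Runs (loop k p) s' t' s'' → Runs (loop k p) s (t + t' + 1) s''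

/-- The control points of a program. -/
def Lab : Prog K A → Type
  | skip => Unit
  | push _ _ => Unit
  | pop _ p => Option (Σ o, Lab (p o))
  | seq p q => Lab p ⊕ Lab q
  | loop _ p => Option (Σ a, Lab (p a))

instance finite_lab [Finite A] : ∀ p : Prog K A, Finite (Lab p)
  | skip => inferInstanceAs (Finite Unit)
  | push _ _ => inferInstanceAs (Finite Unit)
  | pop _ p =>
    have := fun o => finite_lab (p o)
    inferInstanceAs (Finite (Option (Σ o, Lab (p o))))
  | seq p q =>
    have := finite_lab p
    have := finite_lab q
    inferInstanceAs (Finite (Lab p ⊕ Lab q))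
  | loop _ p =>
    have := fun a => finite_lab (p a)
    inferInstanceAs (Finite (Option (Σ a, Lab (p a))))

/-- The initial control point of a program. -/
def entry : (p : Prog K A) → Lab p
  | skip => ()
  | push _ _ => ()
  | pop _ _ => none
  | seq p _ => Sum.inl (entry p)
  | loop _ _ => none

/-- Instructions of a flow chart with control points `L`. -/
inductive Instr (K A L : Type) : Type
  | jump (l : L) : Instr K A L
  | push (k : K) (a : A) (l : L) : Instr K A L
  | pop (k : K) (l : Option A → L) : Instr K A L

/-- One step of a flow chart. -/
def flowStep {L : Type} [DecidableEq K] (m : L → Instr K A L) (c : L × (K → List A)) :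
    L × (K → List A) :=
  match m c.1 with
  | .jump l => (l, c.2)
  | .push k a l => (l, update c.2 k (a :: c.2 k))
  | .pop k l => (l (c.2 k).head?, update c.2 k (c.2 k).tail)

/-- The flow chart of a program, placed in a larger flow chart by `emb` and left to `exit`. -/
def flow {L : Type} : (p : Prog K A) → (exit : L) → (emb : Lab p → L) → Lab p → Instr K A L
  | skip, exit, _, _ => .jump exit
  | push k a, exit, _, _ => .push k a exit
  | pop k p, _, emb, none => .pop k fun o => emb (some ⟨o, entry (p o)⟩)
  | pop _ p, exit, emb, some ⟨o, l⟩ => flow (p o) exit (fun l => emb (some ⟨o, l⟩)) l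
  | seq p q, _, emb, .inl l => flow p (emb (.inr (entry q))) (fun l => emb (.inl l)) l
  | seq _ q, exit, emb, .inr l => flow q exit (fun l => emb (.inr l)) l
  | loop k p, exit, emb, none => .pop k fun o => o.elim exit fun a => emb (some ⟨a, entry (p a)⟩)
  | loop _ p, _, emb, some ⟨a, l⟩ => flow (p a) (emb none) (fun l => emb (some ⟨a, l⟩)) l

section

variable {L : Type} [DecidableEq K] {m : L → Instr K A L} {l : L} {s : K → List A}

theorem flowStep_jump {l' : L} (h : m l = .jump l') : flowStep m (l, s) = (l', s) := by
  simp only [flowStep, h]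

theorem flowStep_push {k : K} {a : A} {l' : L} (h : m l = .push k a l') :
    flowStep m (l, s) = (l', update s k (a :: s k)) := by
  simp only [flowStep, h]

theorem flowStep_pop {k : K} {l' : Option A → L} (h : m l = .pop k l') :
    flowStep m (l, s) = (l' (s k).head?, update s k (s k).tail) := by
  simp only [flowStep, h]

end

/-- Generalizing over `exit` and `emb` lets the induction enter subprograms while the ambient flow
chart `m` stays fixed. -/
theorem Runs.flowStep_iterate {L : Type} [DecidableEq K] {m : L → Instr K A L} {p : Prog K A}
    {s : K → List A} {t : ℕ} {s' : K → List A} (h : Runs p s t s') :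
    ∀ (exit : L) (emb : Lab p → L), (∀ l, m (emb l) = flow p exit emb l) →
      (flowStep m)^[t] (emb (entry p), s) = (exit, s') := by
  induction h with
  | skip s => exact fun exit emb hm => flowStep_jump (hm ())
  | push k a s => exact fun exit emb hm => flowStep_push (hm ())
  | @pop k p s t s' _ ih =>
    intro exit emb hm
    rw [iterate_succ_apply, ← ih exit (fun l => emb (some ⟨_, l⟩)) (fun l => hm (some ⟨_, l⟩))]
    exact congrArg _ (flowStep_pop (hm none))
  | seq _ _ ih ih' =>
    intro exit emb hm
    rw [Nat.add_comm, iterate_add_apply,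
      ← ih' exit (fun l => emb (.inr l)) (fun l => hm (.inr l)),
      ← ih (emb (.inr (entry _))) (fun l => emb (.inl l)) (fun l => hm (.inl l))]
    rfl
  | @loop_nil k p s hs =>
    intro exit emb hm
    refine (flowStep_pop (hm none)).trans ?_
    have : update s k (s k).tail = s := by rw [hs, List.tail_nil, ← hs, update_eq_self]
    rw [this, hs]
    rfl
  | @loop_cons k p s a l t s' t' s'' hs _ _ ih ih' =>
    intro exit emb hm
    rw [← ih' exit emb hm, Nat.add_right_comm, Nat.add_comm, iterate_add_apply,
      iterate_succ_apply]
    refine congrArg _ (Eq.trans ?_ (ih (emb none) (fun l => emb (some ⟨a, l⟩))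
      (fun l => hm (some ⟨a, l⟩))))
    refine congrArg _ ((flowStep_pop (hm none)).trans ?_)
    rw [hs]
    rfl

end Prog

/-- Stacks over `A` together with a stack of truth values. -/
abbrev OutAlphabet (K A : Type) : Option K → Type := fun k => k.elim Bool fun _ => A

namespace Prog

open Function Turing

variable {K A : Type}

/-- Stacks over `A`, together with an empty stack of truth values. -/
def liftStacks (s : K → List A) : (k : Option K) → List (OutAlphabet K A k)
  | none => []
  | some k => s k

theorem update_liftStacks [DecidableEq K] (s : K → List A) (k : K) (l : List A) :
    update (liftStacks s) (some k) l = liftStacks (update s k l) := by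
  funext k'
  rcases k' with _ | k'
  · exact update_of_ne (by simp) _ _
  · by_cases h : k' = k
    · subst h
      exact (update_self ..).trans (update_self k' l s).symm
    · exact (update_of_ne (by simpa using h) _ _).trans
        (update_of_ne (β := fun _ => List A) h l s).symm

/-- The statement of a stack machine that executes an instruction. -/
def Instr.toStmt {L : Type} : Instr K A L → TM2.Stmt (OutAlphabet K A) L (Option A)
  | .jump l => .goto fun _ => l
  | .push k a l => .push (some k) (fun _ => a) (.goto fun _ => l)
  | .pop k l => .pop (some k) (fun _ o => o) (.goto l)

/-- The statement that decides on the top symbol of the stack `k`, whose length is at most three,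
whether to output `true`, and halts. -/
def outputStmt {L : Type} (k : K) (isTrue : Option A → Bool) :
    TM2.Stmt (OutAlphabet K A) L (Option A) :=
  .pop (some k) (fun _ o => o) <| .push none (fun o => isTrue o) <|
    .pop (some k) (fun _ o => o) <| .pop (some k) (fun _ o => o) <| .load (fun _ => none) .halt

/-- The stack machine that runs `p`, with input on the stack `k`, and outputs one truth value. -/
noncomputable def toFinTM2 [DecidableEq K] [Fintype K] [Fintype A] (p : Prog K A) (k : K)
    (isTrue : Option A → Bool) : FinTM2 :=
  letI := Fintype.ofFinite (Lab p)
  { K := Option K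
    k₀ := some k
    k₁ := none
    Γ := OutAlphabet K A
    Λ := Option (Lab p)
    main := some (entry p)
    σ := Option A
    initialState := none
    Γk₀Fin := inferInstanceAs (Fintype A)
    m := fun l => l.elim (outputStmt k isTrue) fun l => (flow p none some l).toStmt }

/-- The machine simulates the chart step by step. The chart idles at `halt`, where the machine is
about to run its output statement; hence only `t' ≤ t`. -/
theorem iterate_flip_bind_step {L : Type} [DecidableEq K]
    (m : L → Instr K A L) (M : L → TM2.Stmt (OutAlphabet K A) L (Option A)) (halt : L)
    (hM : ∀ l, l ≠ halt → M l = (m l).toStmt) (hm : m halt = .jump halt)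
    (t : ℕ) : ∀ (l : L) (s : K → List A) (v : Option A),
      ∃ t' ≤ t, ∃ v', (flip bind (TM2.step M))^[t'] (some ⟨some l, v, liftStacks s⟩) =
        some ⟨some ((flowStep m)^[t] (l, s)).1, v', liftStacks ((flowStep m)^[t] (l, s)).2⟩ := by
  induction t with
  | zero => exact fun l s v => ⟨0, le_rfl, v, rfl⟩
  | succ t ih =>
    intro l s v
    by_cases hl : l = halt
    · subst hl
      have h0 : flowStep m (l, s) = (l, s) := by simp [flowStep, hm]
      have : ∀ t, (flowStep m)^[t] (l, s) = (l, s) := fun t => iterate_fixed h0 t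
      rw [this]
      exact ⟨0, Nat.zero_le _, v, rfl⟩
    · obtain ⟨v₁, h₁⟩ : ∃ v₁, TM2.step M ⟨some l, v, liftStacks s⟩ =
          some ⟨some (flowStep m (l, s)).1, v₁, liftStacks (flowStep m (l, s)).2⟩ := by
        rw [TM2.step, hM l hl]
        rcases hml : m l with l' | ⟨k, a, l'⟩ | ⟨k, l'⟩
        · exact ⟨v, by simp [Instr.toStmt, flowStep, hml]⟩
        · refine ⟨v, ?_⟩
          simp only [Instr.toStmt, flowStep, hml, TM2.stepAux]
          rw [← update_liftStacks]
          rfl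
        · refine ⟨(s k).head?, ?_⟩
          simp only [Instr.toStmt, flowStep, hml, TM2.stepAux]
          rw [← update_liftStacks]
          rfl
      obtain ⟨t', ht', v', h'⟩ := ih (flowStep m (l, s)).1 (flowStep m (l, s)).2 v₁
      refine ⟨t' + 1, by omega, v', ?_⟩
      rw [iterate_succ_apply, iterate_succ_apply, ← h']
      congr 1

/-- The stacks in which only the stack `k` is nonempty, with content `w`. -/
def only [DecidableEq K] (k : K) (w : List A) : K → List A := update (fun _ => []) k w

theorem solvableInPolyTime_of_runs {α : Type} [DecidableEq K] [Fintype K] [Fintype A]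
    (p : Prog K A) (k : K) (isTrue : Option A → Bool) (encode : α → List A) (answer : α → Bool)
    (T : Polynomial ℕ)
    (h : ∀ x, ∃ t ≤ T.eval (encode x).length, ∃ w, Runs p (only k (encode x)) t (only k w) ∧
      w.length ≤ 3 ∧ isTrue w.head? = answer x) :
    SolvableInPolyTime encode answer := by
  classical
  let M := p.toFinTM2 k isTrue
  -- The additional step of time is the output statement.
  refine ⟨{ tm := M, inputAlphabet := Equiv.refl A, outputAlphabet := Equiv.refl Bool,
            time := T + 1, outputsFun := fun x => Classical.choice ?_ }⟩
  obtain ⟨t, ht, w, hr, hw, hans⟩ := h x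
  let m : Option (Lab p) → Instr K A (Option (Lab p)) := fun l =>
    l.elim (.jump none) fun l => flow p none some l
  have hflow := hr.flowStep_iterate (m := m) none some (fun l => rfl)
  obtain ⟨t', ht', v, hv⟩ := iterate_flip_bind_step m M.m none
    (by rintro (_ | l) hl; exact (hl rfl).elim; rfl) rfl t (some (entry p)) (only k (encode x)) none
  rw [hflow] at hv
  refine ⟨⟨⟨t' + 1, ?_⟩, by simpa using ht'.trans ht⟩⟩
  have hmap : ∀ l : List A, List.map (Equiv.refl A).invFun l = l := List.map_id
  have h0 : ∀ l : List A, initList M l = ⟨some (some (entry p)), none, liftStacks (only k l)⟩ := by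
    intro l
    unfold initList
    congr 1
    funext k'
    rcases k' with _ | k'
    · rfl
    · by_cases hk : k' = k
      · subst hk
        exact (dif_pos rfl).trans (update_self (β := fun _ => List A) k' l fun _ => []).symm
      · exact (dif_neg fun h => hk (Option.some.inj h)).trans
          (update_of_ne (β := fun _ => List A) hk l fun _ => []).symm
  have h1 : M.step ⟨some none, v, liftStacks (only k w)⟩ =
      some (haltList M (List.map (Equiv.refl Bool).invFun (Computability.encodeBool (answer x)))) := by
    change some (TM2.stepAux (outputStmt k isTrue) v _) = _
    simp only [outputStmt, TM2.stepAux]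
    unfold haltList
    congr 2
    funext k'
    rcases k' with _ | k'
    · refine Eq.trans ?_ (dif_pos rfl).symm
      rw [update_of_ne (by simp), update_of_ne (by simp), update_self, update_of_ne (by simp)]
      change isTrue (only k w k).head? :: [] = [answer x]
      rw [← hans, only, update_self]
    · refine Eq.trans ?_ (dif_neg (by rintro ⟨⟩)).symm
      by_cases hk : k' = k
      · subst hk
        rw [update_self, update_self, update_of_ne (by simp), update_self]
        change (only k' w k').tail.tail.tail = []
        rw [only, update_self]
        -- A halting configuration must have all other stacks empty; three pops suffice since `w`
        -- has length at most three.
        match w, hw with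
        | [], _ | [_], _ | [_, _], _ | [_, _, _], _ => rfl
      · have hk' : some k' ≠ some k := by simpa using hk
        rw [update_of_ne hk', update_of_ne hk', update_of_ne (by simp), update_of_ne hk']
        exact update_of_ne (β := fun _ => List A) hk w fun _ => []
  refine (congrArg (fun l => (flip bind M.step)^[t' + 1] (some (initList M l))) (hmap _)).trans ?_
  refine (congrArg (fun c => (flip bind M.step)^[t' + 1] (some c)) (h0 _)).trans ?_
  rw [iterate_succ_apply']
  refine (congrArg (flip bind M.step) hv).trans ?_
  exact h1

end Prog

end

/-! ### Subroutines, elementary stack programs and trees on stacks -/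

section

namespace Prog

open Function

variable {K K' A : Type}

/-- Renaming the stacks of a program. -/
def map (e : K → K') : Prog K A → Prog K' A
  | skip => skip
  | push k a => push (e k) a
  | pop k p => pop (e k) fun o => map e (p o)
  | seq p q => seq (map e p) (map e q)
  | loop k p => loop (e k) fun a => map e (p a)

variable [DecidableEq K] [DecidableEq K']

theorem update_comp_of_injective {e : K → K'} (he : Injective e) {S : K' → List A}
    {s : K → List A} (h : ∀ k, S (e k) = s k) (k : K) (w : List A) (k' : K) :
    update S (e k) w (e k') = update s k w k' := by
  by_cases hk : k' = k
  · subst hk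
    simp
  · rw [update_of_ne (he.ne hk), update_of_ne hk, h]

/-- A frame property: stacks outside the range of `e` are untouched, so subroutines on disjoint
stacks do not interfere. -/
theorem Runs.map {e : K → K'} (he : Injective e) {p : Prog K A} {s : K → List A} {t : ℕ}
    {s' : K → List A} (h : Runs p s t s') :
    ∀ S : K' → List A, (∀ k, S (e k) = s k) → ∃ S', Runs (p.map e) S t S' ∧
      (∀ k, S' (e k) = s' k) ∧ ∀ k', (∀ k, e k ≠ k') → S' k' = S k' := by
  induction h with
  | skip s => exact fun S hS => ⟨S, .skip S, hS, fun _ _ => rfl⟩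
  | push k a s =>
    intro S hS
    refine ⟨_, .push (e k) a S, ?_, fun k' hk' => update_of_ne (hk' k).symm _ _⟩
    rw [hS]
    exact update_comp_of_injective he hS k _
  | @pop k p s t s' _ ih =>
    intro S hS
    obtain ⟨S', h1, h2, h3⟩ := ih (update S (e k) (S (e k)).tail)
      (by rw [hS]; exact update_comp_of_injective he hS k _)
    refine ⟨S', ?_, h2, fun k' hk' => (h3 k' hk').trans (update_of_ne (hk' k).symm _ _)⟩
    refine Runs.pop ?_
    rw [hS] at h1 ⊢
    exact h1
  | seq _ _ ih ih' =>
    intro S hS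
    obtain ⟨S', h1, h2, h3⟩ := ih S hS
    obtain ⟨S'', h1', h2', h3'⟩ := ih' S' h2
    exact ⟨S'', h1.seq h1', h2', fun k' hk' => (h3' k' hk').trans (h3 k' hk')⟩
  | @loop_nil k p s hs => exact fun S hS => ⟨S, .loop_nil (by rw [hS, hs]), hS, fun _ _ => rfl⟩
  | @loop_cons k p s a l t s' t' s'' hs _ _ ih ih' =>
    intro S hS
    obtain ⟨S', h1, h2, h3⟩ := ih (update S (e k) l) (update_comp_of_injective he hS k _)
    obtain ⟨S'', h1', h2', h3'⟩ := ih' S' h2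
    exact ⟨S'', .loop_cons (by rw [hS, hs]) h1 h1', h2', fun k' hk' =>
      (h3' k' hk').trans ((h3 k' hk').trans (update_of_ne (hk' k).symm _ _))⟩

/-- Running a renamed program as a subroutine. -/
theorem Runs.call {e : K → K'} (he : Injective e) {p : Prog K A} {k : K} {x y : List A} {t : ℕ}
    (h : Runs p (only k x) t (only k y)) {S : K' → List A} (hx : S (e k) = x)
    (hS : ∀ k', k' ≠ k → S (e k') = []) : Runs (p.map e) S t (update S (e k) y) := by
  obtain ⟨S', h1, h2, h3⟩ := h.map he S fun k' => by
    by_cases hk : k' = k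
    · subst hk
      simp [only, hx]
    · simp [only, hk, hS k' hk]
  convert h1 using 1
  funext k'
  by_cases hk' : ∃ k₁, e k₁ = k'
  · obtain ⟨k₁, rfl⟩ := hk'
    rw [h2]
    by_cases hk : k₁ = k
    · subst hk
      simp [only]
    · simp [only, hk, he.ne hk, hS k₁ hk]
  · push Not at hk'
    rw [h3 k' hk', update_of_ne (hk' k).symm]

/-- A step pushes at most one symbol; hence time bounds are also bounds for output sizes. -/
theorem Runs.length_le {p : Prog K A} {s : K → List A} {t : ℕ} {s' : K → List A}
    (h : Runs p s t s') (k : K) : (s' k).length ≤ (s k).length + t := by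
  induction h with
  | skip s => omega
  | push k' a s =>
    by_cases hk : k = k'
    · subst hk
      simp
    · simp [hk]
  | @pop k' p s t s' _ ih =>
    refine ih.trans ?_
    by_cases hk : k = k'
    · subst hk
      simp
      omega
    · simp [hk]
  | seq _ _ ih ih' => omega
  | loop_nil => omega
  | @loop_cons k' p s a l t s' t' s'' hs _ _ ih ih' =>
    refine ih'.trans ((Nat.add_le_add_right ih _).trans ?_)
    by_cases hk : k = k'
    · subst hk
      simp [hs]
      omega
    · simp [hk]
      omega

theorem Runs.of_eq {p : Prog K A} {s s₁ s₂ : K → List A} {t t₁ : ℕ} (h : Runs p s t s₁)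
    (ht : t = t₁) (hs : s₁ = s₂) : Runs p s t₁ s₂ :=
  ht ▸ hs ▸ h

/-- Moves the content of a stack to another one, reversing it. -/
def reverseTo (a b : K) : Prog K A := loop a fun x => push b x

theorem runs_reverseTo {a b : K} (hab : a ≠ b) (w : List A) : ∀ {s : K → List A}, s a = w →
    Runs (reverseTo a b) s (2 * w.length + 1) (update (update s a []) b (w.reverse ++ s b)) := by
  induction w with
  | nil =>
    refine fun hs => (Runs.loop_nil hs).of_eq rfl ?_
    funext k
    simp only [update_apply]
    split_ifs <;> simp_all
  | cons x w ih =>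
    intro s hs
    refine (Runs.loop_cons hs (.push b x _) (ih (by simp [hab]))).of_eq ?_ ?_
    · simp only [List.length_cons]
      omega
    · funext k
      simp only [update_apply]
      split_ifs <;> simp_all

/-- Moves the content of `a` on top of `b`, through `c`. -/
def moveTo (a c b : K) : Prog K A := seq (reverseTo a c) (reverseTo c b)

theorem runs_moveTo {a c b : K} (hac : a ≠ c) (hcb : c ≠ b) (hab : a ≠ b)
    {s : K → List A} {w : List A} (hs : s a = w) (hc : s c = []) :
    Runs (moveTo a c b) s (4 * w.length + 2) (update (update s a []) b (w ++ s b)) := by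
  refine ((runs_reverseTo hac w hs).seq (runs_reverseTo hcb w.reverse (by simp [hc]))).of_eq ?_ ?_
  · simp only [List.length_reverse]
    omega
  · funext k
    simp only [update_apply]
    split_ifs <;> simp_all

/-- Copies the content of `c`, reversed, to `a` and `b`. -/
def fork (c a b : K) : Prog K A := loop c fun x => seq (push a x) (push b x)

theorem runs_fork {c a b : K} (hca : c ≠ a) (hcb : c ≠ b) (hab : a ≠ b) (w : List A) :
    ∀ {s : K → List A}, s c = w → Runs (fork c a b) s (3 * w.length + 1)
      (update (update (update s c []) a (w.reverse ++ s a)) b (w.reverse ++ s b)) := by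
  induction w with
  | nil =>
    refine fun hs => (Runs.loop_nil hs).of_eq rfl ?_
    funext k
    simp only [update_apply]
    split_ifs <;> simp_all
  | cons x w ih =>
    intro s hs
    refine (Runs.loop_cons hs ((Runs.push a x _).seq (.push b x _))
      (ih (by simp [hca, hcb]))).of_eq ?_ ?_
    · simp only [List.length_cons]
      omega
    · funext k
      simp only [update_apply]
      split_ifs <;> simp_all

/-- Empties a stack. -/
def clear (a : K) : Prog K A := loop a fun _ => skip

theorem runs_clear {a : K} (w : List A) : ∀ {s : K → List A}, s a = w →
    Runs (clear a) s (2 * w.length + 1) (update s a []) := by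
  induction w with
  | nil =>
    refine fun hs => (Runs.loop_nil hs).of_eq rfl ?_
    funext k
    simp only [update_apply]
    split_ifs <;> simp_all
  | cons x w ih =>
    intro s hs
    refine (Runs.loop_cons hs (.skip _) (ih (by simp))).of_eq ?_ (by simp)
    simp only [List.length_cons]
    omega

/-- Pushes a word. -/
def pushWord (a : K) : List A → Prog K A
  | [] => skip
  | x :: w => seq (pushWord a w) (push a x)

theorem runs_pushWord (a : K) (s : K → List A) (w : List A) :
    Runs (pushWord a w) s (w.length + 1) (update s a (w ++ s a)) := by
  induction w with
  | nil => exact (Runs.skip s).of_eq rfl (by simp)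
  | cons x w ih => exact (ih.seq (.push a x _)).of_eq rfl (by simp)

end Prog

/-- Binary trees. -/
inductive BTree : Type
  | leaf
  | node (l r : BTree)

namespace BTree

open Computability

/-- The prefix notation of a binary tree. -/
def str : BTree → List Γ'
  | leaf => [Γ'.bit false]
  | node l r => Γ'.bit true :: (str l ++ str r)

/-- The left subtree. -/
def left : BTree → BTree
  | leaf => leaf
  | node l _ => l

/-- The right subtree. -/
def right : BTree → BTree
  | leaf => leaf
  | node _ r => r

/-- The length of the prefix notation. -/
def size (t : BTree) : ℕ := t.str.length

@[simp]
theorem size_leaf : leaf.size = 1 := rfl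

@[simp]
theorem size_node (l r : BTree) : (node l r).size = l.size + r.size + 1 := by
  simp [size, str]

end BTree

namespace Prog

open Function Computability

variable {K : Type} [DecidableEq K]

/-- One round of the program that moves a tree. -/
def splitRound (a n c : K) : Prog K Γ' :=
  pop a fun o => match o with
    | some (Γ'.bit true) =>
      seq (push c (Γ'.bit true)) (seq (push n Γ'.blank) (push n Γ'.blank))
    | some x => push c x
    | none => skip

/-- Moves the tree on top of `a` to the top of `b`, through `c`, counting pending subtrees on
`n`. -/
def split (a n c b : K) : Prog K Γ' :=
  seq (push n Γ'.blank) (seq (loop n fun _ => splitRound a n c) (reverseTo c b))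

/-- Stated with a continuation: the given run is the rest of the same loop after the tree is
consumed. An inner node replaces one pending subtree by two, so its right subtree supplies the
continuation for its left one. The constant 5 is the cost of a round at an inner node. -/
theorem runs_split_loop {a n c : K} (han : a ≠ n) (hnc : n ≠ c) (hac : a ≠ c) (t : BTree) :
    ∀ {s s'' : K → List Γ'} {r m : List Γ'} {x : Γ'} {T : ℕ},
      s a = t.str ++ r → s n = x :: m →
      Runs (loop n fun _ => splitRound a n c)
        (update (update (update s a r) n m) c (t.str.reverse ++ s c)) T s'' →
      ∃ T' ≤ 5 * t.size + T, Runs (loop n fun _ => splitRound a n c) s T' s'' := by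
  induction t with
  | leaf =>
    intro s s'' r m x T ha hn h
    have ha' : update s n m a = Γ'.bit false :: r := by simp [han, ha, BTree.str]
    have hr : Runs (splitRound a n c) (update s n m) 2
        (update (update (update s a r) n m) c (BTree.leaf.str.reverse ++ s c)) := by
      refine Runs.pop ?_
      rw [ha']
      refine (Runs.push c (Γ'.bit false) _).of_eq rfl ?_
      funext k
      simp only [update_apply]
      split_ifs <;> simp_all [BTree.str]
    refine ⟨_, ?_, Runs.loop_cons hn hr h⟩
    simp only [BTree.size_leaf]
    omega
  | node l r' ihl ihr =>
    intro s s'' r m x T ha hn h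
    obtain ⟨T₂, hT₂, h₂⟩ := ihr
      (s := update (update (update s a (r'.str ++ r)) n (Γ'.blank :: m)) c
        (l.str.reverse ++ Γ'.bit true :: s c)) (r := r) (m := m) (x := Γ'.blank) (T := T)
      (s'' := s'') (by simp [han, hac]) (by simp [hnc]) (by
        convert h using 1
        funext k
        simp only [update_apply]
        split_ifs <;> simp_all [BTree.str])
    obtain ⟨T₁, hT₁, h₁⟩ := ihl
      (s := update (update (update s a (l.str ++ (r'.str ++ r))) n (Γ'.blank :: Γ'.blank :: m)) c
        (Γ'.bit true :: s c)) (r := r'.str ++ r) (m := Γ'.blank :: m) (x := Γ'.blank) (T := T₂)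
      (s'' := s'') (by simp [han, hac]) (by simp [hnc]) (by
        convert h₂ using 1
        funext k
        simp only [update_apply]
        split_ifs <;> simp_all)
    have ha' : update s n m a = Γ'.bit true :: (l.str ++ (r'.str ++ r)) := by
      simp [han, ha, BTree.str]
    have hr : Runs (splitRound a n c) (update s n m) 4 (update (update (update s a
        (l.str ++ (r'.str ++ r))) n (Γ'.blank :: Γ'.blank :: m)) c (Γ'.bit true :: s c)) := by
      refine Runs.pop ?_
      rw [ha']
      refine ((Runs.push c (Γ'.bit true) _).seq ((Runs.push n Γ'.blank _).seq
        (.push n Γ'.blank _))).of_eq rfl ?_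
      funext k
      simp only [update_apply]
      split_ifs <;> simp_all
    refine ⟨_, ?_, Runs.loop_cons hn hr h₁⟩
    simp only [BTree.size_node]
    omega

theorem runs_split {a n c b : K} (han : a ≠ n) (hnc : n ≠ c) (hac : a ≠ c) (hab : a ≠ b)
    (hnb : n ≠ b) (hcb : c ≠ b) (t : BTree) {s : K → List Γ'} {r : List Γ'}
    (ha : s a = t.str ++ r) (hn : s n = []) (hc : s c = []) :
    ∃ T ≤ 7 * t.size + 3,
      Runs (split a n c b) s T (update (update s a r) b (t.str ++ s b)) := by
  obtain ⟨T, hT, h⟩ := runs_split_loop han hnc hac t (s := update s n (Γ'.blank :: s n)) (r := r)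
    (m := []) (x := Γ'.blank) (by simp [han, ha]) (by simp [hn]) (Runs.loop_nil (by simp [hnc]))
  refine ⟨_, ?_, ((Runs.push n Γ'.blank s).seq (h.seq (runs_reverseTo hcb t.str.reverse
    (by simp [hc, hnc.symm])))).of_eq rfl ?_⟩
  · rw [List.length_reverse, ← BTree.size]
    omega
  · funext k
    simp only [update_apply]
    split_ifs <;> simp_all

end Prog

end

/-! ### Polynomial-time transformations of trees -/

section

/-- `T` is given by a polynomial. -/
def PolyBound (T : ℕ → ℕ) : Prop := ∃ P : Polynomial ℕ, ∀ n, T n = P.eval n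

namespace PolyBound

theorem id : PolyBound fun n => n := ⟨.X, by simp⟩

theorem const (c : ℕ) : PolyBound fun _ => c := ⟨.C c, by simp⟩

theorem add {S T : ℕ → ℕ} : PolyBound S → PolyBound T → PolyBound fun n => S n + T n := by
  rintro ⟨P, hP⟩ ⟨Q, hQ⟩
  exact ⟨P + Q, fun n => by simp [hP, hQ]⟩

theorem mul {S T : ℕ → ℕ} : PolyBound S → PolyBound T → PolyBound fun n => S n * T n := by
  rintro ⟨P, hP⟩ ⟨Q, hQ⟩
  exact ⟨P * Q, fun n => by simp [hP, hQ]⟩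

theorem comp {S T : ℕ → ℕ} : PolyBound S → PolyBound T → PolyBound fun n => S (T n) := by
  rintro ⟨P, hP⟩ ⟨Q, hQ⟩
  exact ⟨P.comp Q, fun n => by simp [hP, hQ]⟩

/-- The coefficients are natural numbers. -/
theorem mono {T : ℕ → ℕ} : PolyBound T → Monotone T := by
  rintro ⟨P, hP⟩ m n hmn
  rw [hP, hP]
  induction P using Polynomial.induction_on' generalizing T with
  | add p q hp hq =>
    simp only [Polynomial.eval_add]
    exact Nat.add_le_add (hp fun _ => rfl) (hq fun _ => rfl)
  | monomial k a =>
    simp only [Polynomial.eval_monomial]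
    gcongr

end PolyBound

open Computability Prog Function

section

variable {ι : Type} {n : ι → ℕ} {X Y Z : ι → BTree}

/-- The trees `X i` have size polynomial in `n i`. -/
def PolySize (n : ι → ℕ) (X : ι → BTree) : Prop :=
  ∃ S, PolyBound S ∧ ∀ i, (X i).size ≤ S (n i)

/-- Some program transforms the trees `X i` to `Y i` in time polynomial in `n i`. -/
def CompIn (n : ι → ℕ) (X Y : ι → BTree) : Prop :=
  ∃ (K : Type) (_ : Fintype K) (_ : DecidableEq K) (k : K) (p : Prog K Γ') (T : ℕ → ℕ),
    PolyBound T ∧ ∀ i, ∃ t ≤ T (n i), Runs p (only k (X i).str) t (only k (Y i).str)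

theorem CompIn.polySize (h : CompIn n X Y) (hX : PolySize n X) : PolySize n Y := by
  obtain ⟨K, _, _, k, p, T, hT, h⟩ := h
  obtain ⟨S, hS, hX⟩ := hX
  refine ⟨_, hS.add hT, fun i => ?_⟩
  obtain ⟨t, ht, h⟩ := h i
  have h1 := h.length_le k
  have h2 := hX i
  simp only [only, update_self] at h1
  unfold BTree.size at *
  omega

theorem CompIn.refl : CompIn n X X :=
  ⟨Unit, inferInstance, inferInstance, (), .skip, _, .const 1, fun _ => ⟨1, le_rfl, .skip _⟩⟩

/-- The programs run on disjoint stacks, and the results are carried over through one auxiliary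
stack. Size bounds for `Y` and `Z` pay for this transport. -/
theorem CompIn.trans (hX : PolySize n X) (h₁ : CompIn n X Y) (h₂ : CompIn n Y Z) :
    CompIn n X Z := by
  obtain ⟨S₁, hS₁, hY⟩ := h₁.polySize hX
  obtain ⟨S₂, hS₂, hZ⟩ := h₂.polySize (h₁.polySize hX)
  obtain ⟨K₁, _, _, k₁, p₁, T₁, hT₁, h₁⟩ := h₁
  obtain ⟨K₂, _, _, k₂, p₂, T₂, hT₂, h₂⟩ := h₂
  have he₁ : Injective (Sum.inr ∘ Sum.inl : K₁ → Unit ⊕ K₁ ⊕ K₂) :=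
    Sum.inr_injective.comp Sum.inl_injective
  have he₂ : Injective (Sum.inr ∘ Sum.inr : K₂ → Unit ⊕ K₁ ⊕ K₂) :=
    Sum.inr_injective.comp Sum.inr_injective
  refine ⟨Unit ⊕ K₁ ⊕ K₂, inferInstance, inferInstance, .inr (.inl k₁),
    seq (p₁.map (Sum.inr ∘ Sum.inl)) (seq (moveTo (.inr (.inl k₁)) (.inl ()) (.inr (.inr k₂))) (seq (p₂.map (Sum.inr ∘ Sum.inr))
      (moveTo (.inr (.inr k₂)) (.inl ()) (.inr (.inl k₁))))),
    fun m => T₁ m + T₂ m + (4 * S₁ m + 4 * S₂ m + 4),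
    (hT₁.add hT₂).add ((((PolyBound.const 4).mul hS₁).add ((PolyBound.const 4).mul hS₂)).add
      (.const 4)), fun i => ?_⟩
  obtain ⟨t₁, ht₁, hr₁⟩ := h₁ i
  obtain ⟨t₂, ht₂, hr₂⟩ := h₂ i
  have hY := hY i
  have hZ := hZ i
  refine ⟨_, ?_, ((hr₁.call he₁ (S := only (.inr (.inl k₁)) (X i).str) ?_ ?_).seq
    ((runs_moveTo (w := (Y i).str) ?_ ?_ ?_ ?_ ?_).seq ((hr₂.call he₂ ?_ ?_).seq
      (runs_moveTo (w := (Z i).str) ?_ ?_ ?_ ?_ ?_)))).of_eq rfl ?_⟩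
  · beta_reduce
    unfold BTree.size at *
    omega
  · simp [only]
  · intro k hk
    simp [only, hk]
  · simp
  · simp
  · simp
  · simp
  · simp [only]
  · simp [only]
  · intro k hk
    simp [only, hk]
  · simp
  · simp
  · simp
  · simp
  · simp [only]
  · funext k
    simp only [update_apply, only, comp_apply]
    split_ifs <;> simp_all

theorem CompIn.pair (hX : PolySize n X) (h₁ : CompIn n X Y) (h₂ : CompIn n X Z) :
    CompIn n X fun i => .node (Y i) (Z i) := by
  obtain ⟨S, hS, hXS⟩ := hX
  obtain ⟨S₁, hS₁, hY⟩ := h₁.polySize ⟨S, hS, hXS⟩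
  obtain ⟨S₂, hS₂, hZ⟩ := h₂.polySize ⟨S, hS, hXS⟩
  obtain ⟨K₁, _, _, k₁, p₁, T₁, hT₁, h₁⟩ := h₁
  obtain ⟨K₂, _, _, k₂, p₂, T₂, hT₂, h₂⟩ := h₂
  have he₁ : Injective (Sum.inr ∘ Sum.inl : K₁ → Bool ⊕ K₁ ⊕ K₂) :=
    Sum.inr_injective.comp Sum.inl_injective
  have he₂ : Injective (Sum.inr ∘ Sum.inr : K₂ → Bool ⊕ K₁ ⊕ K₂) :=
    Sum.inr_injective.comp Sum.inr_injective
  refine ⟨Bool ⊕ K₁ ⊕ K₂, inferInstance, inferInstance, .inl true,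
    -- `fork` reverses, so the input is reversed beforehand. Afterwards the second component is
    -- stacked first, leaving the node's bit and the first component on top.
    seq (reverseTo (.inl true) (.inl false))
      (seq (fork (.inl false) (.inr (.inl k₁)) (.inr (.inr k₂)))
        (seq (p₁.map (Sum.inr ∘ Sum.inl)) (seq (p₂.map (Sum.inr ∘ Sum.inr))
          (seq (moveTo (.inr (.inr k₂)) (.inl false) (.inl true))
            (seq (moveTo (.inr (.inl k₁)) (.inl false) (.inl true))
              (push (.inl true) (Γ'.bit true))))))),
    fun m => T₁ m + T₂ m + (4 * S₁ m + 4 * S₂ m + (5 * S m + 7)),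
    (hT₁.add hT₂).add ((((PolyBound.const 4).mul hS₁).add ((PolyBound.const 4).mul hS₂)).add
      (((PolyBound.const 5).mul hS).add (.const 7))), fun i => ?_⟩
  obtain ⟨t₁, ht₁, hr₁⟩ := h₁ i
  obtain ⟨t₂, ht₂, hr₂⟩ := h₂ i
  have hXS := hXS i
  have hY := hY i
  have hZ := hZ i
  refine ⟨_, ?_, ((runs_reverseTo (s := only (.inl true) (X i).str) ?_ (X i).str ?_).seq
    ((runs_fork ?_ ?_ ?_ (X i).str.reverse ?_).seq ((hr₁.call he₁ ?_ ?_).seq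
    ((hr₂.call he₂ ?_ ?_).seq ((runs_moveTo (w := (Z i).str) ?_ ?_ ?_ ?_ ?_).seq
      ((runs_moveTo (w := (Y i).str) ?_ ?_ ?_ ?_ ?_).seq (.push _ _ _))))))).of_eq rfl ?_⟩
  · beta_reduce
    unfold BTree.size at *
    rw [List.length_reverse]
    omega
  · simp
  · simp [only]
  · simp
  · simp
  · simp
  · simp [only]
  · simp [only]
  · intro k hk
    simp [only, hk]
  · simp [only]
  · intro k hk
    simp [only, hk]
  · simp
  · simp
  · simp
  · simp
  · simp [only]
  · simp
  · simp
  · simp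
  · simp
  · simp [only]
  · funext k
    simp only [update_apply, only, comp_apply]
    split_ifs <;> simp_all [BTree.str]

theorem CompIn.const (hX : PolySize n X) (y : BTree) : CompIn n X fun _ => y := by
  obtain ⟨S, hS, hXS⟩ := hX
  refine ⟨Unit, inferInstance, inferInstance, (), seq (clear ()) (pushWord () y.str),
    fun m => 2 * S m + (y.size + 2), ((PolyBound.const 2).mul hS).add (.const _), fun i => ?_⟩
  have hXS := hXS i
  refine ⟨_, ?_, ((runs_clear (s := only () (X i).str) (X i).str ?_).seq
    (runs_pushWord _ _ _)).of_eq rfl ?_⟩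
  · beta_reduce
    unfold BTree.size at *
    omega
  · simp [only]
  · simp [only]

/-- Popping the bit of a node leaves its two subtrees in a row, and `split` detaches the first. For
a leaf the popped bit is restored. -/
theorem CompIn.left (hX : PolySize n X) : CompIn n X fun i => (X i).left := by
  obtain ⟨S, hS, hXS⟩ := hX
  refine ⟨Fin 4, inferInstance, inferInstance, 0, pop 0 fun o =>
    if o = some (Γ'.bit true) then
      seq (split 0 1 2 3) (seq (clear 0) (moveTo 3 2 0)) else push 0 (Γ'.bit false),
    fun m => 20 * S m + 20, ((PolyBound.const 20).mul hS).add (.const _), fun i => ?_⟩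
  have hXS := hXS i
  rcases hXi : X i with _ | ⟨l, r⟩
  · refine ⟨_, ?_, Runs.pop (t := 1) ?_⟩
    · beta_reduce
      omega
    · refine (Runs.push _ _ _).of_eq rfl ?_
      funext k
      simp only [update_apply, only]
      split_ifs <;> simp_all [BTree.str, BTree.left]
  · have h0 : (only (0 : Fin 4) (BTree.node l r).str 0).head? = some (Γ'.bit true) := by
      simp [only, BTree.str]
    obtain ⟨t, ht, h⟩ := runs_split (a := (0 : Fin 4)) (n := 1) (c := 2) (b := 3) (by decide)
      (by decide) (by decide) (by decide) (by decide) (by decide) l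
      (s := update (only (0 : Fin 4) (BTree.node l r).str) 0
        (only (0 : Fin 4) (BTree.node l r).str 0).tail) (r := r.str)
      (by simp [only, BTree.str]) (by simp [only]) (by simp [only])
    refine ⟨_, ?_, Runs.pop (t := t + ((2 * r.size + 1) + (4 * l.size + 2))) ?_⟩
    · rw [hXi, BTree.size_node] at hXS
      beta_reduce
      omega
    · rw [h0, if_pos rfl]
      refine (h.seq ((runs_clear r.str ?_).seq
        (runs_moveTo (w := l.str) ?_ ?_ ?_ ?_ ?_))).of_eq rfl ?_
      · simp [only]
      · decide
      · decide
      · decide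
      · simp [only]
      · simp [only]
      · funext k
        simp only [update_apply, only]
        split_ifs <;> simp_all [BTree.str, BTree.left]

theorem CompIn.right (hX : PolySize n X) : CompIn n X fun i => (X i).right := by
  obtain ⟨S, hS, hXS⟩ := hX
  refine ⟨Fin 4, inferInstance, inferInstance, 0, pop 0 fun o =>
    if o = some (Γ'.bit true) then
      seq (split 0 1 2 3) (clear 3) else push 0 (Γ'.bit false),
    fun m => 20 * S m + 20, ((PolyBound.const 20).mul hS).add (.const _), fun i => ?_⟩
  have hXS := hXS i
  rcases hXi : X i with _ | ⟨l, r⟩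
  · refine ⟨_, ?_, Runs.pop (t := 1) ?_⟩
    · beta_reduce
      omega
    · refine (Runs.push _ _ _).of_eq rfl ?_
      funext k
      simp only [update_apply, only]
      split_ifs <;> simp_all [BTree.str, BTree.right]
  · have h0 : (only (0 : Fin 4) (BTree.node l r).str 0).head? = some (Γ'.bit true) := by
      simp [only, BTree.str]
    obtain ⟨t, ht, h⟩ := runs_split (a := (0 : Fin 4)) (n := 1) (c := 2) (b := 3) (by decide)
      (by decide) (by decide) (by decide) (by decide) (by decide) l
      (s := update (only (0 : Fin 4) (BTree.node l r).str) 0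
        (only (0 : Fin 4) (BTree.node l r).str 0).tail) (r := r.str)
      (by simp [only, BTree.str]) (by simp [only]) (by simp [only])
    refine ⟨_, ?_, Runs.pop (t := t + (2 * l.size + 1)) ?_⟩
    · rw [hXi, BTree.size_node] at hXS
      beta_reduce
      omega
    · rw [h0, if_pos rfl]
      refine (h.seq (runs_clear l.str ?_)).of_eq rfl ?_
      · simp [only]
      · funext k
        simp only [update_apply, only]
        split_ifs <;> simp_all [BTree.str, BTree.right]

end

end

/-! ### Encodings by trees, and folds -/

section

open Computability Prog Function

/-- Types whose elements are represented by binary trees. -/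
class Enc (α : Type) where
  /-- The tree that represents an element. -/
  enc : α → BTree

namespace Enc

variable {α β : Type}

instance : Enc Unit := ⟨fun _ => .leaf⟩

/-- The truth values share their trees with the lists `[()]` and `[]`, which turns branching into a
fold. -/
instance : Enc Bool := ⟨fun b => cond b (.node .leaf .leaf) .leaf⟩

/-- Unary notation, the same tree as a list of `n` units; numbers only serve as indices, counters
and symbol codes. -/
instance : Enc ℕ := ⟨fun n => n.rec .leaf fun _ t => .node .leaf t⟩

instance [Enc α] [Enc β] : Enc (α × β) := ⟨fun x => .node (enc x.1) (enc x.2)⟩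

instance [Enc α] : Enc (List α) := ⟨fun l => l.foldr (fun a t => .node (enc a) t) .leaf⟩

/-- The size of the representation of an element. -/
def size [Enc α] (x : α) : ℕ := (enc x).size

theorem size_bool_le (b : Bool) : size b ≤ 3 := by
  cases b <;> simp [size, enc]

theorem size_prod [Enc α] [Enc β] (x : α × β) : size x = size x.1 + size x.2 + 1 :=
  BTree.size_node _ _

@[simp]
theorem enc_nil [Enc α] : enc ([] : List α) = .leaf := rfl

@[simp]
theorem enc_cons [Enc α] (a : α) (l : List α) : enc (a :: l) = .node (enc a) (enc l) := rfl

@[simp]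
theorem size_nil [Enc α] : size ([] : List α) = 1 := rfl

@[simp]
theorem size_cons [Enc α] (a : α) (l : List α) : size (a :: l) = size a + size l + 1 :=
  BTree.size_node _ _

theorem size_le_of_mem [Enc α] {a : α} {l : List α} (h : a ∈ l) : size a ≤ size l := by
  induction l with
  | nil => simp at h
  | cons b l ih =>
    rw [size_cons]
    rcases List.mem_cons.1 h with rfl | h
    · omega
    · have := ih h
      omega

theorem length_le_size [Enc α] (l : List α) : l.length ≤ size l := by
  induction l with
  | nil => simp
  | cons a l ih =>
    simp only [List.length_cons, size_cons]
    omega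

theorem size_le_of_forall_mem [Enc α] {l : List α} {m : ℕ} (h : ∀ a ∈ l, size a ≤ m) :
    size l ≤ l.length * (m + 1) + 1 := by
  induction l with
  | nil => simp
  | cons a l ih =>
    have h1 := h a (by simp)
    have h2 := ih fun b hb => h b (by simp [hb])
    simp only [size_cons, List.length_cons, Nat.add_mul]
    omega

theorem size_append [Enc α] (l l' : List α) : size (l ++ l') + 1 = size l + size l' := by
  induction l with
  | nil => simp [Nat.add_comm]
  | cons a l ih =>
    simp only [List.cons_append, size_cons]
    omega

end Enc

open Enc

variable {α β γ σ : Type} [Enc α] [Enc β] [Enc γ] [Enc σ]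

/-- The function `f` is computable in polynomial time. -/
def PolyTime (f : α → β) : Prop := CompIn size enc fun x => enc (f x)

theorem polySize_size : PolySize (size : α → ℕ) enc := ⟨_, .id, fun _ => le_rfl⟩

section Fold

variable {K : Type} [DecidableEq K]

/-- One round of the program for `List.foldl`: the stacks `0` to `3` hold the remaining list, the
accumulator, a counter and an auxiliary word. -/
def foldRound (p : Prog K Γ') (k : K) (a : Γ') : Prog (Fin 4 ⊕ K) Γ' :=
  if a = Γ'.bit true then
    seq (split (Sum.inl 0) (Sum.inl 2) (Sum.inl 3) (Sum.inr k)) (seq (moveTo (Sum.inl 1) (Sum.inl 3) (Sum.inr k))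
      (seq (push (Sum.inr k) (Γ'.bit true)) (seq (p.map .inr) (moveTo (Sum.inr k) (Sum.inl 3) (Sum.inl 1)))))
  else skip

theorem runs_foldRound {p : Prog K Γ'} {k : K} {g : σ × α → σ} {T : ℕ → ℕ} (hT : Monotone T)
    (hp : ∀ x, ∃ t ≤ T (size x), Runs p (only k (enc x).str) t (only k (enc (g x)).str))
    (s : σ) (a : α) {M : ℕ} (hs : size s ≤ M) (ha : size a ≤ M) (hg : size (g (s, a)) ≤ M)
    {S : Fin 4 ⊕ K → List Γ'} {r : List Γ'} (h0 : S (Sum.inl 0) = (enc a).str ++ r)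
    (h1 : S (Sum.inl 1) = (enc s).str) (h2 : S (Sum.inl 2) = []) (h3 : S (Sum.inl 3) = [])
    (hk : ∀ k, S (Sum.inr k) = []) :
    ∃ t ≤ T (2 * M + 1) + 15 * M + 10, Runs (foldRound p k (Γ'.bit true)) S t
      (update (update S (Sum.inl 0) r) (Sum.inl 1) (enc (g (s, a))).str) := by
  obtain ⟨t₁, ht₁, hr₁⟩ := runs_split (a := Sum.inl 0) (n := Sum.inl 2) (c := Sum.inl 3) (b := Sum.inr k)
    (by simp) (by simp) (by simp) (by simp) (by simp) (by simp) (enc a) h0 h2 h3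
  obtain ⟨t₂, ht₂, hr₂⟩ := hp (s, a)
  -- The body is called on a pair, whose size is that of both components plus one.
  have hle : T (size (s, a)) ≤ T (2 * M + 1) := hT (by rw [size_prod]; simp only; omega)
  rw [foldRound, if_pos rfl]
  refine ⟨_, ?_, (hr₁.seq ((runs_moveTo (w := (enc s).str) ?_ ?_ ?_ ?_ ?_).seq
    ((Runs.push _ _ _).seq ((hr₂.call Sum.inr_injective ?_ ?_).seq
    (runs_moveTo (w := (enc (g (s, a))).str) ?_ ?_ ?_ ?_ ?_))))).of_eq rfl ?_⟩
  · unfold size at *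
    unfold BTree.size at *
    omega
  · simp
  · simp
  · simp
  · simp [h1]
  · simp [h3]
  · simp [hk, enc, BTree.str]
  · intro k' hk'
    simp [hk', hk]
  · simp
  · simp
  · simp
  · simp
  · simp [h3]
  · funext k
    simp only [update_apply]
    split_ifs <;> simp_all

/-- The loop pops the leading bit of the list, `true` for a further item and `false` for the end.
The bound over all prefixes controls every intermediate accumulator. -/
theorem runs_foldLoop {p : Prog K Γ'} {k : K} {g : σ × α → σ} {T : ℕ → ℕ} (hT : Monotone T)
    (hp : ∀ x, ∃ t ≤ T (size x), Runs p (only k (enc x).str) t (only k (enc (g x)).str))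
    {M : ℕ} (l : List α) : ∀ {s : σ} {S : Fin 4 ⊕ K → List Γ'},
    (∀ l₁ l₂, l = l₁ ++ l₂ → size (l₁.foldl (fun s a => g (s, a)) s) ≤ M) → size l ≤ M →
    S (Sum.inl 0) = (enc l).str → S (Sum.inl 1) = (enc s).str → S (Sum.inl 2) = [] → S (Sum.inl 3) = [] →
    (∀ k, S (Sum.inr k) = []) →
    ∃ t ≤ l.length * (T (2 * M + 1) + 15 * M + 11) + 3, Runs (loop (Sum.inl 0) (foldRound p k)) S t
      (update (update S (Sum.inl 0) []) (Sum.inl 1)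
        (enc (l.foldl (fun s a => g (s, a)) s)).str) := by
  induction l with
  | nil =>
    intro s S _ _ h0 h1 h2 h3 hk
    refine ⟨3, by simp, (Runs.loop_cons (t := 1) (t' := 1) h0 (Runs.skip _)
      (Runs.loop_nil (by simp))).of_eq rfl ?_⟩
    simp [← h1]
  | cons a l ih =>
    intro s S hM hl h0 h1 h2 h3 hk
    rw [size_cons] at hl
    obtain ⟨t₁, ht₁, hr₁⟩ := runs_foldRound hT hp s a (M := M) (hM [] (a :: l) rfl) (by omega)
      (hM [a] l rfl) (S := update S (Sum.inl 0) ((enc a).str ++ (enc l).str)) (r := (enc l).str)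
      (by simp) (by simp [h1]) (by simp [h2]) (by simp [h3]) (by simp [hk])
    obtain ⟨t₂, ht₂, hr₂⟩ := ih (s := g (s, a))
      (S := update (update S (Sum.inl 0) (enc l).str) (Sum.inl 1) (enc (g (s, a))).str)
      (fun l₁ l₂ h => hM (a :: l₁) l₂ (by rw [h]; rfl)) (by omega)
      (by simp) (by simp) (by simp [h2]) (by simp [h3]) (by simp [hk])
    refine ⟨_, ?_, (Runs.loop_cons h0 (hr₁.of_eq rfl (by simp)) hr₂).of_eq rfl ?_⟩
    · rw [List.length_cons, Nat.succ_mul]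
      omega
    · funext k
      simp only [update_apply]
      split_ifs <;> simp_all

end Fold

/-- The bound `B` on intermediate accumulators is essential: a polynomial-time body could otherwise
square its accumulator's size in each round. -/
theorem CompIn.foldl {ι : Type} {n : ι → ℕ} {s : ι → σ} {l : ι → List α} {g : σ × α → σ}
    (hg : PolyTime g) {B : ℕ → ℕ} (hB : PolyBound B)
    (hs : ∀ i l₁ l₂, l i = l₁ ++ l₂ → size (l₁.foldl (fun s a => g (s, a)) (s i)) ≤ B (n i))
    (hl : ∀ i, size (l i) ≤ B (n i)) :
    CompIn n (fun i => enc (s i, l i))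
      fun i => enc ((l i).foldl (fun s a => g (s, a)) (s i)) := by
  obtain ⟨K, _, _, k, p, T, hT, h⟩ := hg
  refine ⟨Fin 4 ⊕ K, inferInstance, inferInstance, Sum.inl 0,
    pop (Sum.inl 0) fun _ => seq (split (Sum.inl 0) (Sum.inl 2) (Sum.inl 3) (Sum.inl 1))
      (seq (loop (Sum.inl 0) (foldRound p k)) (moveTo (Sum.inl 1) (Sum.inl 3) (Sum.inl 0))),
    fun m => B m * (T (2 * B m + 1) + 15 * B m + 11) + (15 * B m + 20),
    (hB.mul (((hT.comp (((PolyBound.const 2).mul hB).add (.const 1))).add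
      ((PolyBound.const 15).mul hB)).add (.const 11))).add
      (((PolyBound.const 15).mul hB).add (.const 20)), fun i => ?_⟩
  have hs0 := hs i [] _ rfl
  have hs1 := hs i (l i) [] (by simp)
  obtain ⟨t₁, ht₁, hr₁⟩ := runs_split (K := Fin 4 ⊕ K) (a := Sum.inl 0) (n := Sum.inl 2) (c := Sum.inl 3)
    (b := Sum.inl 1) (by simp) (by simp) (by simp) (by simp) (by simp) (by simp) (enc (s i))
    (s := only (Sum.inl 0) ((enc (s i)).str ++ (enc (l i)).str)) (r := (enc (l i)).str)
    (by simp [only]) (by simp [only]) (by simp [only])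
  obtain ⟨t₂, ht₂, hr₂⟩ := runs_foldLoop (k := k) hT.mono h (l i) (s := s i) (hs i) (hl i)
    (S := update (update (only (Sum.inl 0 : Fin 4 ⊕ K) ((enc (s i)).str ++ (enc (l i)).str)) (Sum.inl 0)
      (enc (l i)).str) (Sum.inl 1) ((enc (s i)).str ++
        only (Sum.inl 0 : Fin 4 ⊕ K) ((enc (s i)).str ++ (enc (l i)).str) (Sum.inl 1)))
    (by simp [only]) (by simp [only]) (by simp [only]) (by simp [only]) (by simp [only])
  refine ⟨_, ?_, Runs.pop (t := t₁ + (t₂ + (4 * size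
    ((l i).foldl (fun s a => g (s, a)) (s i)) + 2))) ?_⟩
  · have h1 := Nat.mul_le_mul_right (T (2 * B (n i) + 1) + 15 * B (n i) + 11)
      ((length_le_size (l i)).trans (hl i))
    rw [List.foldl_nil] at hs0
    unfold size at *
    beta_reduce
    omega
  · have h0 : ∀ S : Fin 4 ⊕ K → List Γ', S = only (Sum.inl 0) (enc (s i, l i)).str →
        update S (Sum.inl 0) (S (Sum.inl 0)).tail =
          only (Sum.inl 0) ((enc (s i)).str ++ (enc (l i)).str) := by
      rintro S rfl
      simp [only, enc, BTree.str]
    rw [h0 _ rfl]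
    refine (hr₁.seq (hr₂.seq (runs_moveTo ?_ ?_ ?_ ?_ ?_))).of_eq rfl ?_
    · simp
    · simp
    · simp
    · simp
    · simp [only]
    · funext k
      simp only [update_apply, only]
      split_ifs <;> simp_all

end

/-! ### Closure properties of polynomial-time functions -/

section

open Computability Prog Function Enc

section

variable {α β γ δ σ : Type} [Enc α] [Enc β] [Enc γ] [Enc δ] [Enc σ]

theorem CompIn.reindex {ι κ : Type} {n : ι → ℕ} {X Y : ι → BTree} (h : CompIn n X Y) (e : κ → ι)
    {m : κ → ℕ} {B : ℕ → ℕ} (hB : PolyBound B) (hm : ∀ j, n (e j) ≤ B (m j)) :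
    CompIn m (fun j => X (e j)) fun j => Y (e j) := by
  obtain ⟨K, i₁, i₂, k, p, T, hT, h⟩ := h
  refine ⟨K, i₁, i₂, k, p, _, hT.comp hB, fun j => ?_⟩
  obtain ⟨t, ht, h⟩ := h (e j)
  exact ⟨t, ht.trans (hT.mono (hm j)), h⟩

namespace PolyTime

theorem exists_size_le {f : α → β} (hf : PolyTime f) :
    ∃ B, PolyBound B ∧ ∀ x, size (f x) ≤ B (size x) :=
  CompIn.polySize hf polySize_size

/-- Values of different types with the same tree are interchangeable at no cost. -/
theorem of_enc {f : α → β} {g : α → γ} (hg : PolyTime g) (h : ∀ x, enc (f x) = enc (g x)) :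
    PolyTime f := by
  unfold PolyTime
  simp only [h]
  exact hg

theorem id : PolyTime fun x : α => x := CompIn.refl

theorem const (y : β) : PolyTime fun _ : α => y := CompIn.const polySize_size _

theorem comp {g : β → γ} {f : α → β} (hg : PolyTime g) (hf : PolyTime f) :
    PolyTime fun x => g (f x) := by
  obtain ⟨B, hB, h⟩ := hf.exists_size_le
  exact CompIn.trans polySize_size hf (CompIn.reindex hg f hB h)

theorem pair {f : α → β} {g : α → γ} (hf : PolyTime f) (hg : PolyTime g) :
    PolyTime fun x => (f x, g x) := CompIn.pair polySize_size hf hg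

theorem left {f : α → β} (h : ∀ x, enc (f x) = (enc x).left) : PolyTime f := by
  have := CompIn.left (polySize_size (α := α))
  unfold PolyTime
  simpa only [h]

theorem right {f : α → β} (h : ∀ x, enc (f x) = (enc x).right) : PolyTime f := by
  have := CompIn.right (polySize_size (α := α))
  unfold PolyTime
  simpa only [h]

theorem fst {f : α → β × γ} (hf : PolyTime f) : PolyTime fun x => (f x).1 :=
  comp (g := Prod.fst) (left fun _ => rfl) hf

theorem snd {f : α → β × γ} (hf : PolyTime f) : PolyTime fun x => (f x).2 :=
  comp (g := Prod.snd) (right fun _ => rfl) hf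

theorem cons {f : α → β} {g : α → List β} (hf : PolyTime f) (hg : PolyTime g) :
    PolyTime fun x => f x :: g x :=
  of_enc (hf.pair hg) fun _ => rfl

theorem tail {f : α → List β} (hf : PolyTime f) : PolyTime fun x => (f x).tail :=
  comp (g := List.tail) (right fun l => by cases l <;> rfl) hf

/-- The body may use the context `c`, which is therefore carried along in the accumulator. -/
theorem foldl {l : γ → List α} {s : γ → σ} {g : γ → σ → α → σ} (hl : PolyTime l)
    (hs : PolyTime s) (hg : PolyTime fun x : (γ × σ) × α => g x.1.1 x.1.2 x.2) {B : ℕ → ℕ}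
    (hB : PolyBound B)
    (h : ∀ c l₁ l₂, l c = l₁ ++ l₂ → size (l₁.foldl (g c) (s c)) ≤ B (size c)) :
    PolyTime fun c => (l c).foldl (g c) (s c) := by
  let g' : (γ × σ) × α → γ × σ := fun x => (x.1.1, g x.1.1 x.1.2 x.2)
  have hg' : PolyTime g' := pair (fst (fst id)) hg
  have key : ∀ (c : γ) (l : List α) (s : σ),
      l.foldl (fun s a => g' (s, a)) (c, s) = (c, l.foldl (g c) s) := by
    intro c l
    induction l with
    | nil => exact fun s => rfl
    | cons a l ih => exact fun s => ih _
  obtain ⟨Bl, hBl, hl'⟩ := hl.exists_size_le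
  have hfold := CompIn.foldl (n := (size : γ → ℕ)) (s := fun c => (c, s c)) (l := l) hg'
    ((hBl.add hB).add (PolyBound.id.add (.const 1)))
    (fun c l₁ l₂ hc => by
      have := h c l₁ l₂ hc
      rw [key, size_prod]
      simp only
      omega) (fun c => by
      have := hl' c
      omega)
  have : PolyTime fun c => (l c).foldl (fun s a => g' (s, a)) (c, s c) :=
    CompIn.trans polySize_size (pair (pair id hs) hl) hfold
  simpa only [key] using this.snd

/-- Additive growth by a polynomial in the context alone, over polynomially many rounds, stays
polynomial. -/
theorem foldl_of_growth {l : γ → List α} {s : γ → σ} {g : γ → σ → α → σ} (hl : PolyTime l)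
    (hs : PolyTime s) (hg : PolyTime fun x : (γ × σ) × α => g x.1.1 x.1.2 x.2) {Q : ℕ → ℕ}
    (hQ : PolyBound Q) (h : ∀ c s, ∀ a ∈ l c, size (g c s a) ≤ size s + Q (size c)) :
    PolyTime fun c => (l c).foldl (g c) (s c) := by
  obtain ⟨Bl, hBl, hl'⟩ := hl.exists_size_le
  obtain ⟨Bs, hBs, hs'⟩ := hs.exists_size_le
  refine foldl hl hs hg (hBs.add (hBl.mul hQ)) fun c l₁ l₂ hc => ?_
  have key : ∀ l₁ : List α, (∀ a ∈ l₁, a ∈ l c) → ∀ s,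
      size (l₁.foldl (g c) s) ≤ size s + l₁.length * Q (size c) := by
    intro l₁
    induction l₁ with
    | nil => simp
    | cons a l₁ ih =>
      intro hmem s
      have h1 := ih (fun b hb => hmem b (by simp [hb])) (g c s a)
      have h2 := h c s a (hmem a (by simp))
      rw [List.length_cons, Nat.succ_mul]
      simp only [List.foldl_cons]
      omega
  have h1 := key l₁ (fun a ha => by simp [hc, ha]) (s c)
  have h2 := hs' c
  have h3 : l₁.length ≤ Bl (size c) := by
    refine le_trans ?_ ((length_le_size (l c)).trans (hl' c))
    simp [hc]
  have := Nat.mul_le_mul_right (Q (size c)) h3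
  omega

/-- The condition, read as a list of length one or zero, drives a fold that starts at `g x` and
overwrites it by `f x`. -/
theorem cond {c : γ → Bool} {f g : γ → σ} (hc : PolyTime c) (hf : PolyTime f) (hg : PolyTime g) :
    PolyTime fun x => bif c x then f x else g x := by
  have hl : PolyTime fun x => bif c x then [()] else [] :=
    of_enc hc fun x => by cases c x <;> rfl
  obtain ⟨Q, hQ, hf'⟩ := hf.exists_size_le
  have := foldl_of_growth (g := fun c _ _ => f c) hl hg (hf.comp (fst (fst id))) hQ
    fun c s a _ => (hf' c).trans (by omega)
  convert this using 2 with x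
  cases c x <;> rfl

theorem not {f : γ → Bool} (hf : PolyTime f) : PolyTime fun x => !f x := by
  convert hf.cond (const false) (const true) using 2 with x
  cases f x <;> rfl

theorem and {f g : γ → Bool} (hf : PolyTime f) (hg : PolyTime g) :
    PolyTime fun x => f x && g x := by
  convert hf.cond hg (const false) using 2 with x
  cases f x <;> rfl

theorem or {f g : γ → Bool} (hf : PolyTime f) (hg : PolyTime g) :
    PolyTime fun x => f x || g x := by
  convert hf.cond (const true) hg using 2 with x
  cases f x <;> rfl

theorem bool_beq {f g : γ → Bool} (hf : PolyTime f) (hg : PolyTime g) :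
    PolyTime fun x => f x == g x := by
  convert hf.cond hg hg.not using 2 with x
  cases f x <;> cases g x <;> rfl

theorem reverse {l : γ → List α} (hl : PolyTime l) : PolyTime fun x => (l x).reverse := by
  obtain ⟨B, hB, hl'⟩ := hl.exists_size_le
  have := foldl_of_growth (s := fun _ => []) (g := fun _ s a => a :: s) hl (const [])
    (cons (snd id) (snd (fst id))) (hB.add (.const 1)) fun c s a ha => by
      have := (size_le_of_mem ha).trans (hl' c)
      rw [size_cons]
      omega
  convert this using 2 with x
  have key : ∀ l s : List α, l.foldl (fun s a => a :: s) s = l.reverse ++ s := by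
    intro l
    induction l with
    | nil => simp
    | cons a l ih => simp
  simp [key]

theorem foldr_of_growth {l : γ → List α} {s : γ → σ} {g : γ → α → σ → σ} (hl : PolyTime l)
    (hs : PolyTime s) (hg : PolyTime fun x : (γ × σ) × α => g x.1.1 x.2 x.1.2) {Q : ℕ → ℕ}
    (hQ : PolyBound Q) (h : ∀ c s, ∀ a ∈ l c, size (g c a s) ≤ size s + Q (size c)) :
    PolyTime fun c => (l c).foldr (g c) (s c) := by
  simpa only [List.foldl_reverse] using
    foldl_of_growth (g := fun c s a => g c a s) hl.reverse hs hg hQ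
      fun c s a ha => h c s a (List.mem_reverse.1 ha)

theorem exists_size_le_of_mem {l : γ → List α} (hl : PolyTime l) {h : γ → α → β}
    (hh : PolyTime fun x : γ × α => h x.1 x.2) :
    ∃ B, PolyBound B ∧ ∀ c, ∀ a ∈ l c, size (h c a) ≤ B (size c) := by
  obtain ⟨B, hB, hl'⟩ := hl.exists_size_le
  obtain ⟨B', hB', hh'⟩ := hh.exists_size_le
  refine ⟨_, hB'.comp (PolyBound.id.add (hB.add (.const 1))), fun c a ha => ?_⟩
  refine (hh' (c, a)).trans (hB'.mono ?_)
  have := (size_le_of_mem ha).trans (hl' c)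
  rw [size_prod]
  simp only
  omega

theorem append {f g : γ → List α} (hf : PolyTime f) (hg : PolyTime g) :
    PolyTime fun x => f x ++ g x := by
  obtain ⟨B, hB, hf'⟩ := hf.exists_size_le
  have := foldr_of_growth (g := fun _ a s => a :: s) hf hg (cons (snd id) (snd (fst id)))
    (hB.add (.const 1)) fun c s a ha => by
      have := (size_le_of_mem ha).trans (hf' c)
      rw [size_cons]
      omega
  simpa using this

theorem flatMap {l : γ → List α} {h : γ → α → List β} (hl : PolyTime l)
    (hh : PolyTime fun x : γ × α => h x.1 x.2) : PolyTime fun c => (l c).flatMap (h c) := by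
  obtain ⟨B, hB, hlh⟩ := exists_size_le_of_mem hl hh
  have := foldr_of_growth (s := fun _ => []) (g := fun c a s => h c a ++ s) hl (const [])
    (append (hh.comp (pair (fst (fst id)) (snd id))) (snd (fst id))) hB fun c s a ha => by
      have h1 := hlh c a ha
      have h2 := size_append (h c a) s
      omega
  convert this using 2 with x
  induction l x with
  | nil => rfl
  | cons a l ih => simp [ih]

theorem map {l : γ → List α} {h : γ → α → β} (hl : PolyTime l)
    (hh : PolyTime fun x : γ × α => h x.1 x.2) : PolyTime fun c => (l c).map (h c) := by
  convert flatMap (h := fun c a => [h c a]) hl (hh.cons (const [])) using 2 with x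
  induction l x with
  | nil => rfl
  | cons a l ih => simp [ih]

theorem filter {l : γ → List α} {h : γ → α → Bool} (hl : PolyTime l)
    (hh : PolyTime fun x : γ × α => h x.1 x.2) : PolyTime fun c => (l c).filter (h c) := by
  convert flatMap (h := fun c a => bif h c a then [a] else []) hl
    (hh.cond (cons (snd id) (const [])) (const [])) using 2 with x
  induction l x with
  | nil => rfl
  | cons a l ih => cases ha : h x a <;> simp [ih, ha]

theorem any {l : γ → List α} {h : γ → α → Bool} (hl : PolyTime l)
    (hh : PolyTime fun x : γ × α => h x.1 x.2) : PolyTime fun c => (l c).any (h c) := by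
  have := foldr_of_growth (s := fun _ => false) (g := fun c a s => h c a || s) hl (const false)
    (or (hh.comp (pair (fst (fst id)) (snd id))) (snd (fst id))) (.const 3)
    fun c s a ha => (size_bool_le _).trans (by omega)
  convert this using 2 with x
  induction l x with
  | nil => rfl
  | cons a l ih => simp [ih]

theorem all {l : γ → List α} {h : γ → α → Bool} (hl : PolyTime l)
    (hh : PolyTime fun x : γ × α => h x.1 x.2) : PolyTime fun c => (l c).all (h c) := by
  convert (any (h := fun c a => !h c a) hl hh.not).not using 2 with x
  induction l x with
  | nil => rfl
  | cons a l ih => simp [ih]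

theorem headD {l : γ → List α} (hl : PolyTime l) (d : α) : PolyTime fun c => (l c).headD d := by
  obtain ⟨B, hB, hl'⟩ := hl.exists_size_le
  have := foldr_of_growth (s := fun _ => d) (g := fun _ a _ => a) hl (const d) (snd id) hB
    fun c s a ha => by
      have := (size_le_of_mem ha).trans (hl' c)
      omega
  convert this using 2 with x
  cases l x <;> rfl

/-- Reduces arithmetic to lists: successor is `cons`, subtraction is `drop`, and iteration is a
fold. -/
theorem enc_replicate (n : ℕ) : enc (List.replicate n ()) = enc n := by
  induction n with
  | zero => rfl
  | succ n ih =>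
    rw [List.replicate_succ, enc_cons, ih]
    rfl

theorem size_nat (n : ℕ) : size n = 2 * n + 1 := by
  induction n with
  | zero => rfl
  | succ n ih =>
    have : size (n + 1) = size n + 2 := by
      change (BTree.node .leaf (enc n)).size = _
      rw [BTree.size_node, BTree.size_leaf]
      unfold size
      omega
    omega

theorem replicate {f : γ → ℕ} (hf : PolyTime f) : PolyTime fun x => List.replicate (f x) () :=
  of_enc hf fun _ => enc_replicate _

theorem length {l : γ → List α} (hl : PolyTime l) : PolyTime fun x => (l x).length :=
  of_enc (map (h := fun _ _ => ()) hl (const ())) fun x => by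
    rw [← enc_replicate, List.map_const']

theorem succ {f : γ → ℕ} (hf : PolyTime f) : PolyTime fun x => f x + 1 := by
  simpa using (cons (const ()) hf.replicate).length

theorem iterate {k : γ → ℕ} {s : γ → σ} {g : γ → σ → σ} (hk : PolyTime k) (hs : PolyTime s)
    (hg : PolyTime fun x : γ × σ => g x.1 x.2) {B : ℕ → ℕ} (hB : PolyBound B)
    (h : ∀ c, ∀ j ≤ k c, size ((g c)^[j] (s c)) ≤ B (size c)) :
    PolyTime fun c => (g c)^[k c] (s c) := by
  have key : ∀ (c : γ) (l : List Unit) (s : σ),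
      l.foldl (fun s _ => g c s) s = (g c)^[l.length] s := by
    intro c l
    induction l with
    | nil => exact fun _ => rfl
    | cons a l ih => exact fun s => by rw [List.foldl_cons, ih]; rfl
  have := foldl (g := fun c s (_ : Unit) => g c s) hk.replicate hs (hg.comp (fst id)) hB
    fun c l₁ l₂ hl => by
      rw [key]
      refine h c _ ?_
      have := congrArg List.length hl
      simp only [List.length_replicate, List.length_append] at this
      omega
  simpa [key] using this

theorem drop {f : γ → ℕ} {l : γ → List α} (hf : PolyTime f) (hl : PolyTime l) :
    PolyTime fun x => (l x).drop (f x) := by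
  have key : ∀ n (l : List α), List.tail^[n] l = l.drop n := by
    intro n
    induction n with
    | zero => exact fun _ => rfl
    | succ n ih =>
      intro l
      rw [iterate_succ_apply, ih, List.drop_tail]
  have hle : ∀ n (l : List α), size (l.drop n) ≤ size l := by
    intro n
    induction n with
    | zero => simp
    | succ n ih =>
      rintro (_ | ⟨a, l⟩)
      · simp
      · have := ih l
        rw [List.drop_succ_cons, size_cons]
        omega
  obtain ⟨B, hB, hl'⟩ := hl.exists_size_le
  simpa only [key] using iterate (g := fun _ s => List.tail s) hf hl (tail (snd id)) hB
    fun c j _ => by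
      rw [key]
      exact (hle _ _).trans (hl' c)

theorem getD {l : γ → List α} {f : γ → ℕ} (hl : PolyTime l) (hf : PolyTime f) (d : α) :
    PolyTime fun x => (l x).getD (f x) d := by
  convert (drop hf hl).headD d using 2 with x
  simp [List.headD_eq_head?_getD, List.getD_eq_getElem?_getD]

theorem isEmpty {l : γ → List α} (hl : PolyTime l) : PolyTime fun x => (l x).isEmpty := by
  convert (any (h := fun _ _ => true) hl (const true)).not using 2 with x
  cases l x <;> simp

theorem sub {f g : γ → ℕ} (hf : PolyTime f) (hg : PolyTime g) : PolyTime fun x => f x - g x := by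
  simpa using (drop hg hf.replicate).length

theorem nat_beq {f g : γ → ℕ} (hf : PolyTime f) (hg : PolyTime g) :
    PolyTime fun x => f x == g x := by
  convert and (sub hf hg).replicate.isEmpty (sub hg hf).replicate.isEmpty using 2 with x
  rw [Bool.eq_iff_iff]
  simp
  omega

theorem range {f : γ → ℕ} (hf : PolyTime f) : PolyTime fun x => List.range (f x) := by
  obtain ⟨B, hB, hf'⟩ := hf.exists_size_le
  -- The list is built backwards next to a counter. Unary entries make its size quadratic.
  have key : ∀ n, (fun s : List ℕ × ℕ => (s.2 :: s.1, s.2 + 1))^[n] ([], 0) =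
      ((List.range n).reverse, n) := by
    intro n
    induction n with
    | zero => rfl
    | succ n ih => rw [iterate_succ_apply', ih]; simp [List.range_succ]
  have := iterate (s := fun _ => (([], 0) : List ℕ × ℕ))
    (g := fun _ s => (s.2 :: s.1, s.2 + 1)) hf (const _)
    (pair (cons (snd (snd id)) (fst (snd id))) (succ (snd (snd id))))
    ((hB.mul (hB.add (.const 1))).add (hB.add (.const 2))) fun c j hj => by
      rw [key, size_prod]
      have h1 := hf' c
      have h2 : size (List.range j).reverse ≤ (List.range j).reverse.length * (2 * j + 1 + 1) + 1 :=
        size_le_of_forall_mem fun a ha => by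
          simp only [List.mem_reverse, List.mem_range] at ha
          rw [size_nat]
          omega
      rw [size_nat] at h1 ⊢
      rw [List.length_reverse, List.length_range] at h2
      have h3 : j * (2 * j + 1 + 1) ≤ B (size c) * (B (size c) + 1) := by
        gcongr <;> omega
      simp only
      omega
  simpa [key] using this.fst.reverse

theorem list_beq {f g : γ → List Bool} (hf : PolyTime f) (hg : PolyTime g) :
    PolyTime fun x => f x == g x := by
  convert and (nat_beq hf.length hg.length) (all (l := fun x => List.range (f x).length)
    (h := fun x i => (f x).getD i false == (g x).getD i false) hf.length.range
    (bool_beq (getD (hf.comp (fst id)) (snd id) false) (getD (hg.comp (fst id)) (snd id) false)))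
    using 2 with x
  rw [Bool.eq_iff_iff]
  simp only [beq_iff_eq, Bool.and_eq_true, List.all_eq_true, List.mem_range]
  constructor
  · intro h
    simp [h]
  · rintro ⟨h1, h2⟩
    refine List.ext_getElem h1 fun i hi hi' => ?_
    have := h2 i hi
    simpa [List.getD_eq_getElem?_getD, hi, hi'] using this

/-- Here `L` is part of the program, not of the data, so its elements need no encoding and each has
its own subprogram. -/
theorem any_const {ι : Type} (L : List ι) {h : ι → γ → Bool} (hh : ∀ i, PolyTime (h i)) :
    PolyTime fun x => L.any fun i => h i x := by
  induction L with
  | nil => exact const false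
  | cons i L ih => exact or (hh i) ih

theorem all_const {ι : Type} (L : List ι) {h : ι → γ → Bool} (hh : ∀ i, PolyTime (h i)) :
    PolyTime fun x => L.all fun i => h i x := by
  induction L with
  | nil => exact const true
  | cons i L ih => exact and (hh i) ih

end PolyTime

instance : Enc Γ' := ⟨fun a => match a with
  | .blank => enc 0
  | .comma => enc 1
  | .bra => enc 2
  | .ket => enc 3
  | .bit false => enc 4
  | .bit true => enc 5⟩

theorem size_symbol_le (a : Γ') : size a ≤ 11 := by
  rcases a with _ | ⟨_ | _⟩ | _ | _ | _ <;> decide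

theorem PolyTime.symbol_beq {f : γ → Γ'} (hf : PolyTime f) (a : Γ') :
    PolyTime fun x => f x == a := by
  let code : Γ' → ℕ := fun a => match a with
    | .blank => 0
    | .comma => 1
    | .bra => 2
    | .ket => 3
    | .bit false => 4
    | .bit true => 5
  have hcode : PolyTime fun x => code (f x) := of_enc hf fun x => by
    rcases f x with _ | ⟨_ | _⟩ | _ | _ | _ <;> rfl
  convert nat_beq hcode (const (code a)) using 2 with x
  generalize f x = b
  revert a b
  decide

/-- The program that transforms a word to the representation of the list of its symbols. -/
def encodeInput (K : Type) (k : K) : Prog (Unit ⊕ K) Γ' :=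
  seq (reverseTo (.inr k) (.inl ())) (seq (push (.inr k) (Γ'.bit false))
    (loop (.inl ()) fun a => pushWord (.inr k) (Γ'.bit true :: (enc a).str)))

/-- The list is built from its end, starting with the bit of the empty list. A symbol contributes at
most 12 bits, hence at most 14 steps per round. -/
theorem runs_encodeInput {K : Type} [DecidableEq K] (k : K) (w : List Γ') :
    ∃ t ≤ 20 * w.length + 20, Runs (encodeInput K k) (only (.inr k) w) t
      (only (.inr k) (enc w).str) := by
  have key : ∀ (w l : List Γ') (S : Unit ⊕ K → List Γ'), S (.inl ()) = w →
      S (.inr k) = (enc l).str → ∃ t ≤ 14 * w.length + 1,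
      Runs (loop (.inl ()) fun a => pushWord (.inr k) (Γ'.bit true :: (enc a).str)) S t
        (update (update S (.inl ()) []) (.inr k) (enc (w.reverse ++ l)).str) := by
    intro w
    induction w with
    | nil =>
      intro l S h0 h1
      refine ⟨1, by simp, (Runs.loop_nil h0).of_eq rfl ?_⟩
      funext k
      simp only [update_apply]
      split_ifs <;> simp_all
    | cons a w ih =>
      intro l S h0 h1
      obtain ⟨t, ht, hr⟩ := ih (a :: l)
        (update (update S (.inl ()) w) (.inr k) (enc (a :: l)).str) (by simp) (by simp)
      refine ⟨_, ?_, (Runs.loop_cons h0 ((runs_pushWord _ _ _).of_eq rfl ?_) hr).of_eq rfl ?_⟩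
      · have := size_symbol_le a
        unfold size BTree.size at this
        simp only [List.length_cons]
        omega
      · simp [h1, BTree.str]
      · funext k
        simp only [update_apply]
        split_ifs <;> simp_all
  let S₁ : Unit ⊕ K → List Γ' := update (update (only (.inr k) w) (.inr k) []) (.inl ())
    (w.reverse ++ only (Sum.inr k : Unit ⊕ K) w (Sum.inl ()))
  obtain ⟨t, ht, hr⟩ := key w.reverse [] (update S₁ (.inr k) (Γ'.bit false :: S₁ (.inr k)))
    (by simp [S₁, only]) (by simp [S₁, BTree.str])
  refine ⟨_, ?_, ((runs_reverseTo (by simp) w (by simp [only])).seq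
    ((Runs.push _ _ _).seq hr)).of_eq rfl ?_⟩
  · rw [List.length_reverse] at ht
    omega
  · funext k
    simp only [update_apply, only, S₁]
    split_ifs <;> simp_all

theorem PolyTime.solvableInPolyTime {ι : Type} {encode : ι → List Γ'} {answer : ι → Bool}
    {f : List Γ' → Bool} (hf : PolyTime f) (h : ∀ x, f (encode x) = answer x) :
    SolvableInPolyTime encode answer := by
  obtain ⟨K, _, _, k, p, T, hT, hp⟩ := hf
  -- A word of length `n` has a tree of size at most `12 n + 1`: at most 11 for each symbol and one
  -- per list cell.
  obtain ⟨P, hP⟩ : PolyBound fun n => 20 * n + 20 + T (n * 12 + 1) :=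
    (((PolyBound.const 20).mul .id).add (.const 20)).add
      (hT.comp ((PolyBound.id.mul (.const 12)).add (.const 1)))
  refine solvableInPolyTime_of_runs (seq (encodeInput K k) (p.map .inr)) (.inr k)
    (fun o => o == some (Γ'.bit true)) encode answer P fun x => ?_
  obtain ⟨t₁, ht₁, hr₁⟩ := runs_encodeInput k (encode x)
  obtain ⟨t₂, ht₂, hr₂⟩ := hp (encode x)
  have hle : T (size (encode x)) ≤ T ((encode x).length * 12 + 1) :=
    hT.mono (size_le_of_forall_mem fun a _ => size_symbol_le a)
  refine ⟨t₁ + t₂, ?_, (enc (f (encode x))).str, (hr₁.seq (hr₂.call Sum.inr_injective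
    (by simp [only]) fun k' hk' => by simp [only, hk'])).of_eq rfl (by simp [only]), ?_, ?_⟩
  · rw [← hP]
    beta_reduce
    omega
  · exact size_bool_le _
  · rw [← h]
    cases f (encode x) <;> rfl

end

end

/-! ### The decision procedure on matrices -/

section

open Computability Function

/-- An entry of a matrix of truth values given by its rows. -/
def cell (M : List (List Bool)) (i j : ℕ) : Bool := (M.getD i []).getD j false

/-- A square matrix given by its entries. -/
def table (n : ℕ) (φ : ℕ → ℕ → Bool) : List (List Bool) :=
  (List.range n).map fun i => (List.range n).map fun j => φ i j

/-- Extends a set of paths in the relation `R` by one step. -/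
def pathStep (n : ℕ) (R M : List (List Bool)) : List (List Bool) :=
  table n fun i j => cell R i j || (List.range n).any fun h => cell M i h && cell R h j

/-- The transitive closure of an acyclic relation. -/
def pathMatrix (n : ℕ) (R : List (List Bool)) : List (List Bool) := (pathStep n R)^[n] []

/-- The facts that survive with respect to the set of facts `J`, for the hyperedges `E` and the
transitive priority `M`. -/
def survivorStep (n : ℕ) (E M : List (List Bool)) (J : List Bool) : List Bool :=
  (List.range n).map fun j => !E.any fun e => e.getD j false &&
    (List.range n).all fun i => !e.getD i false || (i == j || (J.getD i false && cell M i j))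

/-- The fixpoint of `survivorStep`. -/
def survivors (n : ℕ) (E M : List (List Bool)) : List Bool := (survivorStep n E M)^[n] []

/-- The decision procedure for c-categoricity, on the rows `E` of the incidence matrix of the
hyperedges and the rows `R` of the adjacency matrix of the priority. -/
def isCategorical (E R : List (List Bool)) : Bool :=
  !E.any fun e => (List.range R.length).all fun i =>
    !e.getD i false || (survivors R.length E (pathMatrix R.length R)).getD i false

theorem cell_table {n i j : ℕ} (φ : ℕ → ℕ → Bool) (hi : i < n) (hj : j < n) :
    cell (table n φ) i j = φ i j := by
  simp [cell, table, List.getD_eq_getElem?_getD, hi, hj]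

theorem getD_map_range {n j : ℕ} (φ : ℕ → Bool) (hj : j < n) :
    ((List.range n).map φ).getD j false = φ j := by
  simp [List.getD_eq_getElem?_getD, hj]

section Correctness

variable {F : Type} {D : PrioritizingInstance F} {fs : List F}

/-- `r` is the incidence vector of `e` with respect to the list of facts `fs`. -/
def IsRow (fs : List F) (e : Finset F) (r : List Bool) : Prop :=
  ∀ i (hi : i < fs.length), r.getD i false = true ↔ fs[i] ∈ e

/-- After `k` rounds every path to a fact of rank below `k` is found, since the last step of a path
starts at a fact of smaller rank. Ranks are below the number of facts. The initial `[]` reads as the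
zero matrix. -/
theorem cell_pathMatrix_iff (hfs : ∀ f, f ∈ fs ↔ f ∈ D.facts) {R : List (List Bool)}
    (hR : ∀ i j (hi : i < fs.length) (hj : j < fs.length),
      cell R i j = true ↔ D.prior fs[i] fs[j]) (hn : D.facts.card ≤ fs.length)
    {i j : ℕ} (hi : i < fs.length) (hj : j < fs.length) :
    cell (pathMatrix fs.length R) i j = true ↔ Relation.TransGen D.prior fs[i] fs[j] := by
  have hstep : ∀ k, cell ((pathStep fs.length R)^[k + 1] []) i j = true ↔ cell R i j = true ∨
      ∃ h < fs.length, cell ((pathStep fs.length R)^[k] []) i h = true ∧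
        cell R h j = true := by
    intro k
    rw [iterate_succ_apply', pathStep, cell_table _ hi hj]
    simp
  have sound : ∀ k j (hj : j < fs.length), cell ((pathStep fs.length R)^[k] []) i j = true →
      Relation.TransGen D.prior fs[i] fs[j] := by
    intro k
    induction k with
    | zero => simp [cell]
    | succ k ih =>
      intro j hj h
      rw [iterate_succ_apply', pathStep, cell_table _ hi hj] at h
      simp only [Bool.or_eq_true, List.any_eq_true, List.mem_range, Bool.and_eq_true] at h
      rcases h with h | ⟨m, hm, h1, h2⟩
      · exact .single ((hR i j hi hj).1 h)
      · exact (ih m hm h1).tail ((hR m j hm hj).1 h2)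
  have complete : ∀ k j (hj : j < fs.length), Relation.TransGen D.prior fs[i] fs[j] →
      D.rank fs[j] < k → cell ((pathStep fs.length R)^[k] []) i j = true := by
    intro k
    induction k with
    | zero => intro j hj _ h; omega
    | succ k ih =>
      intro j hj h hk
      rw [iterate_succ_apply', pathStep, cell_table _ hi hj]
      simp only [Bool.or_eq_true, List.any_eq_true, List.mem_range, Bool.and_eq_true]
      rcases Relation.TransGen.tail'_iff.1 h with ⟨g, hg, hgj⟩
      rcases Relation.reflTransGen_iff_eq_or_transGen.1 hg with rfl | hg
      · exact Or.inl ((hR i j hi hj).2 hgj)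
      · obtain ⟨m, hm, rfl⟩ := List.getElem_of_mem
          ((hfs g).2 (D.mem_facts_of_prior hgj).1)
        have := D.rank_lt_rank (.single hgj)
        exact Or.inr ⟨m, hm, ih m hm hg (by omega), (hR m j hm hj).2 hgj⟩
  refine ⟨sound _ j hj, fun h => complete _ j hj h ?_⟩
  exact (D.rank_lt_card ((hfs _).1 (List.getElem_mem hj))).trans_le hn

/-- The iteration on vectors mirrors the abstract one from the empty set. Rows and hyperedges only
have to match as sets, so order and repetitions do not matter. -/
theorem getD_survivors_iff (hfs : ∀ f, f ∈ fs ↔ f ∈ D.facts) (hnd : fs.Nodup)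
    {E M : List (List Bool)}
    (hE : ∀ r ∈ E, ∃ e ∈ D.edges, IsRow fs e r) (hE' : ∀ e ∈ D.edges, ∃ r ∈ E, IsRow fs e r)
    (hM : ∀ i j (hi : i < fs.length) (hj : j < fs.length),
      cell M i j = true ↔ Relation.TransGen D.prior fs[i] fs[j]) (k : ℕ) :
    ∀ j (hj : j < fs.length), ((survivorStep fs.length E M)^[k] []).getD j false = true ↔
      D.Survives^[k] (fun _ => False) fs[j] := by
  induction k with
  | zero => simp
  | succ k ih =>
    intro j hj
    rw [iterate_succ_apply', iterate_succ_apply', survivorStep, getD_map_range _ hj,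
      PrioritizingInstance.Survives, Bool.not_eq_true', ← Bool.not_eq_true]
    refine not_congr ?_
    simp only [List.any_eq_true, Bool.and_eq_true, List.all_eq_true, List.mem_range,
      Bool.or_eq_true, Bool.not_eq_true', beq_iff_eq]
    have key : ∀ r e, e ∈ D.edges → IsRow fs e r → ((r.getD j false = true ∧ ∀ i < fs.length,
        r.getD i false = false ∨ i = j ∨
          ((survivorStep fs.length E M)^[k] []).getD i false = true ∧ cell M i j = true) ↔
        fs[j] ∈ e ∧ ∀ g ∈ e, g ≠ fs[j] →
          D.Survives^[k] (fun _ => False) g ∧ Relation.TransGen D.prior g fs[j]) := by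
      intro r e he hr
      refine and_congr (hr j hj) ⟨fun h g hg hgj => ?_, fun h i hi => ?_⟩
      · obtain ⟨i, hi, rfl⟩ := List.getElem_of_mem ((hfs g).2 (D.edges_subset e he hg))
        rcases h i hi with h | rfl | ⟨h1, h2⟩
        · rw [← hr i hi, h] at hg
          cases hg
        · exact (hgj rfl).elim
        · exact ⟨(ih i hi).1 h1, (hM i j hi hj).1 h2⟩
      · by_cases hie : fs[i] ∈ e
        · by_cases hij : i = j
          · exact Or.inr (Or.inl hij)
          · obtain ⟨h1, h2⟩ := h _ hie fun h => hij ((hnd.getElem_inj_iff).1 h)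
            exact Or.inr (Or.inr ⟨(ih i hi).2 h1, (hM i j hi hj).2 h2⟩)
        · rw [← hr i hi, Bool.not_eq_true] at hie
          exact Or.inl hie
    constructor
    · rintro ⟨r, hr, h⟩
      obtain ⟨e, he, her⟩ := hE r hr
      exact ⟨e, he, (key r e he her).1 h⟩
    · rintro ⟨e, he, h⟩
      obtain ⟨r, hr, her⟩ := hE' e he
      exact ⟨r, hr, (key r e he her).2 h⟩

theorem isCategorical_iff (hfs : ∀ f, f ∈ fs ↔ f ∈ D.facts) (hnd : fs.Nodup)
    {E R : List (List Bool)} (hE : ∀ r ∈ E, ∃ e ∈ D.edges, IsRow fs e r)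
    (hE' : ∀ e ∈ D.edges, ∃ r ∈ E, IsRow fs e r) (hlen : R.length = fs.length)
    (hR : ∀ i j (hi : i < fs.length) (hj : j < fs.length),
      cell R i j = true ↔ D.prior fs[i] fs[j]) :
    isCategorical E R = true ↔ D.CCategorical := by
  classical
  have hcard : D.facts.card = fs.length := by
    rw [← List.toFinset_card_of_nodup hnd]
    congr 1
    ext f
    simp [hfs]
  have hsurv := getD_survivors_iff hfs hnd hE hE' (M := pathMatrix fs.length R)
    (fun i j hi hj => cell_pathMatrix_iff hfs hR hcard.le hi hj) fs.length
  rw [(D.isFixpoint_iterate fun _ => False).cCategorical_iff, PrioritizingInstance.Consistent,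
    and_iff_right (Finset.filter_subset _ _), isCategorical, hlen, Bool.not_eq_true',
    ← Bool.not_eq_true, hcard]
  simp only [List.any_eq_true, List.all_eq_true, List.mem_range, Bool.or_eq_true,
    Bool.not_eq_true', not_exists, not_and]
  have key : ∀ r e, e ∈ D.edges → IsRow fs e r → ((∀ i < fs.length, r.getD i false = false ∨
      (survivors fs.length E (pathMatrix fs.length R)).getD i false = true) ↔
      e ⊆ D.facts.filter (D.Survives^[fs.length] fun _ => False)) := by
    intro r e he hr
    refine ⟨fun h g hg => ?_, fun h i hi => ?_⟩
    · have hgD := D.edges_subset e he hg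
      obtain ⟨i, hi, rfl⟩ := List.getElem_of_mem ((hfs g).2 hgD)
      refine Finset.mem_filter.2 ⟨hgD, (hsurv i hi).1 ((h i hi).resolve_left fun h => ?_)⟩
      rw [← hr i hi, h] at hg
      cases hg
    · by_cases hie : fs[i] ∈ e
      · exact Or.inr ((hsurv i hi).2 (Finset.mem_filter.1 (h hie)).2)
      · rw [← hr i hi, Bool.not_eq_true] at hie
        exact Or.inl hie
  constructor
  · intro h e he hsub
    obtain ⟨r, hr, her⟩ := hE' e he
    exact h r hr ((key r e he her).2 hsub)
  · intro h r hr hall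
    obtain ⟨e, he, her⟩ := hE r hr
    exact h e he ((key r e he her).1 hall)

end Correctness

namespace PolyTime

open Enc

variable {γ : Type} [Enc γ]

theorem cell {M : γ → List (List Bool)} {i j : γ → ℕ} (hM : PolyTime M) (hi : PolyTime i)
    (hj : PolyTime j) : PolyTime fun x => cell (M x) (i x) (j x) :=
  (hM.getD hi []).getD hj false

theorem size_table_le (n : ℕ) (φ : ℕ → ℕ → Bool) :
    size (table n φ) ≤ n * (n * 4 + 1 + 1) + 1 := by
  have := size_le_of_forall_mem (l := table n φ) (m := n * 4 + 1) fun r hr => by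
    simp only [table, List.mem_map, List.mem_range] at hr
    obtain ⟨i, -, rfl⟩ := hr
    simpa using size_le_of_forall_mem (l := (List.range n).map fun j => φ i j)
      fun b _ => size_bool_le b
  simpa [table] using this

/-- Each binder extends the context by a pair: `id.snd` is the innermost variable, and every `.fst`
before the final `.snd` moves one binder outwards. -/
theorem pathStep {n : γ → ℕ} {R M : γ → List (List Bool)} (hn : PolyTime n) (hR : PolyTime R)
    (hM : PolyTime M) : PolyTime fun x => pathStep (n x) (R x) (M x) :=
  map hn.range (map (hn.range.comp id.fst) (or
    (cell (hR.comp id.fst.fst) id.fst.snd id.snd)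
    (any (hn.range.comp id.fst.fst) (and
      (cell (hM.comp id.fst.fst.fst) id.fst.fst.snd id.snd)
      (cell (hR.comp id.fst.fst.fst) id.snd id.fst.snd)))))

theorem pathMatrix {n : γ → ℕ} {R : γ → List (List Bool)} (hn : PolyTime n) (hR : PolyTime R) :
    PolyTime fun x => pathMatrix (n x) (R x) := by
  obtain ⟨B, hB, hn'⟩ := hn.exists_size_le
  refine iterate (s := fun _ => []) (g := fun x M => _root_.pathStep (n x) (R x) M) hn (const [])
    (pathStep (hn.comp id.fst) (hR.comp id.fst) id.snd)
    ((hB.mul (((hB.mul (.const 4)).add (.const 1)).add (.const 1))).add (.const 1))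
    fun c j hj => ?_
  -- After the first round every iterate is an `n × n` table, whatever the number of rounds.
  cases j with
  | zero => simp
  | succ j =>
    rw [iterate_succ_apply']
    refine (size_table_le _ _).trans ?_
    have := hn' c
    rw [size_nat] at this
    have : n c ≤ B (size c) := by omega
    gcongr

theorem survivorStep {n : γ → ℕ} {E M : γ → List (List Bool)} {J : γ → List Bool}
    (hn : PolyTime n) (hE : PolyTime E) (hM : PolyTime M) (hJ : PolyTime J) :
    PolyTime fun x => survivorStep (n x) (E x) (M x) (J x) :=
  map hn.range (not (any (hE.comp id.fst) (and (getD id.snd id.fst.snd false)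
    (all (hn.range.comp id.fst.fst) (or (not (getD id.fst.snd id.snd false))
      (or (nat_beq id.snd id.fst.fst.snd) (and (getD (hJ.comp id.fst.fst.fst) id.snd false)
        (cell (hM.comp id.fst.fst.fst) id.snd id.fst.fst.snd))))))))

theorem survivors {n : γ → ℕ} {E M : γ → List (List Bool)} (hn : PolyTime n) (hE : PolyTime E)
    (hM : PolyTime M) : PolyTime fun x => survivors (n x) (E x) (M x) := by
  obtain ⟨B, hB, hn'⟩ := hn.exists_size_le
  refine iterate (s := fun _ => []) (g := fun x J => _root_.survivorStep (n x) (E x) (M x) J) hn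
    (const []) (survivorStep (hn.comp id.fst) (hE.comp id.fst) (hM.comp id.fst) id.snd)
    ((hB.mul (.const 4)).add (.const 1)) fun c j hj => ?_
  cases j with
  | zero => simp
  | succ j =>
    rw [iterate_succ_apply']
    refine (size_le_of_forall_mem fun b _ => size_bool_le b).trans ?_
    have := hn' c
    rw [size_nat] at this
    simp only [_root_.survivorStep, List.length_map, List.length_range]
    omega

theorem isCategorical {E R : γ → List (List Bool)} (hE : PolyTime E) (hR : PolyTime R) :
    PolyTime fun x => isCategorical (E x) (R x) :=
  not (any hE (all (hR.length.range.comp id.fst) (or (not (getD id.fst.snd id.snd false))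
    (getD (survivors (hR.length.comp id.fst.fst) (hE.comp id.fst.fst)
      (pathMatrix (hR.length.comp id.fst.fst) (hR.comp id.fst.fst))) id.snd false))))

end PolyTime

end

/-! ### Parsing inputs, and functional dependencies -/

section

open Computability Function

/-- The state of the parser, which reads from the right: the current word and the complete words of
the current item, the complete items of the current block, and the complete blocks. -/
abbrev ParserState : Type :=
  (List Bool × List (List Bool)) × (List (List (List Bool)) × List (List (List (List Bool))))

/-- One step of the parser. -/
def parseStep (a : Γ') (s : ParserState) : ParserState :=
  bif a == Γ'.bit true then ((true :: s.1.1, s.1.2), s.2)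
  else bif a == Γ'.bit false then ((false :: s.1.1, s.1.2), s.2)
  else bif a == Γ'.comma then (([], s.1.1 :: s.1.2), s.2)
  else bif a == Γ'.bra then (([], []), ((s.1.1 :: s.1.2) :: s.2.1, s.2.2))
  else bif a == Γ'.blank then (s.1, ([], s.2.1 :: s.2.2))
  else s

theorem parseStep_bit (b : Bool) (s : ParserState) :
    parseStep (Γ'.bit b) s = ((b :: s.1.1, s.1.2), s.2) := by
  cases b <;> rfl

theorem parseStep_comma (s : ParserState) :
    parseStep Γ'.comma s = (([], s.1.1 :: s.1.2), s.2) := rfl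

theorem parseStep_bra (s : ParserState) :
    parseStep Γ'.bra s = (([], []), ((s.1.1 :: s.1.2) :: s.2.1, s.2.2)) := rfl

theorem parseStep_ket (s : ParserState) : parseStep Γ'.ket s = s := rfl

theorem parseStep_blank (s : ParserState) :
    parseStep Γ'.blank s = (s.1, ([], s.2.1 :: s.2.2)) := rfl

/-- The state of the parser between two items. -/
def parsed (items : List (List (List Bool))) (blocks : List (List (List (List Bool)))) :
    ParserState :=
  (([], []), (items, blocks))

/-- Splits an input into blocks separated by blanks, items in brackets, and words. -/
def parse (w : List Γ') : List (List (List (List Bool))) :=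
  let s := w.foldr parseStep (parsed [] [])
  s.2.1 :: s.2.2

theorem parse_encBits (w : List Bool) (s : ParserState) :
    (encBits w).foldr parseStep s = ((w ++ s.1.1, s.1.2), s.2) := by
  induction w with
  | nil => rfl
  | cons b w ih => rw [encBits, List.map_cons, List.foldr_cons, ← encBits, ih, parseStep_bit]; rfl

theorem parse_encRow (w : List Bool) (items : List (List (List Bool)))
    (blocks : List (List (List (List Bool)))) :
    (encRow w).foldr parseStep (parsed items blocks) = parsed ([w] :: items) blocks := by
  simp [encRow, parse_encBits, parseStep_bra, parseStep_ket, parsed]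

/-- Reading from the right, each constant, even an empty one, is completed by its comma, and the
relation number by the opening bracket. -/
theorem parse_encFact {S : RelSignature} (f : DBFact S) (items : List (List (List Bool)))
    (blocks : List (List (List (List Bool)))) :
    (encFact f).foldr parseStep (parsed items blocks) =
      parsed ((encodeNat f.1 :: List.ofFn f.2) :: items) blocks := by
  have key : ∀ (l : List DBConst) (items : List (List (List Bool))),
      (l.flatMap fun c => Γ'.comma :: encBits c).foldr parseStep (parsed items blocks) =
        (([], l), (items, blocks)) := by
    intro l items
    induction l with
    | nil => rfl
    | cons c l ih =>
      rw [List.flatMap_cons, List.foldr_append, ih, List.foldr_cons, parse_encBits]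
      simp [parseStep_comma]
  simp only [encFact, List.cons_append, List.foldr_append, List.foldr_cons, List.foldr_nil,
    parseStep_ket, key, parse_encBits, parseStep_bra]
  simp [parsed]

theorem parse_flatMap {α : Type} {g : α → List Γ'} {row : α → List (List Bool)}
    {blocks : List (List (List (List Bool)))}
    (h : ∀ a items, (g a).foldr parseStep (parsed items blocks) = parsed (row a :: items) blocks)
    (l : List α) : (l.flatMap g).foldr parseStep (parsed [] blocks) =
      parsed (l.map row) blocks := by
  induction l with
  | nil => rfl
  | cons a l ih => rw [List.flatMap_cons, List.foldr_append, ih, h, List.map_cons]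

theorem parse_blank (items : List (List (List Bool)))
    (blocks : List (List (List (List Bool)))) :
    parseStep Γ'.blank (parsed items blocks) = parsed [] (items :: blocks) := rfl

-- The blocks `b₁` and `b₂`, signature and facts, stay anonymous: the answer depends only on the two
-- matrices.
open Classical in
theorem CCatInput.parse_encode (x : CCatInput) : ∃ b₁ b₂, parse x.encode = [b₁, b₂,
    x.edgeList.map fun e => [x.factList.map fun f => decide (f ∈ e)],
    x.factList.map fun f => [x.factList.map fun g => decide (x.inst.prior f g)]] := by
  unfold parse CCatInput.encode encRelation encEdges encSignature
  simp only [List.foldr_append, List.foldr_cons]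
  rw [parse_flatMap fun f items => parse_encRow _ items _, parse_blank,
    parse_flatMap fun f items => parse_encRow _ items _, parse_blank,
    parse_flatMap fun f items => parse_encFact f items _, parse_blank,
    parse_flatMap fun f items => parse_encRow _ items _]
  exact ⟨(List.ofFn x.sig.arity).map fun a => [encodeNat a],
    x.factList.map fun f => encodeNat f.1 :: List.ofFn f.2, by simp only [parsed]; congr!⟩

open Classical in
theorem FDCCatInput.parse_encode {S : RelSignature} {Δ : Set (FD S)} (x : FDCCatInput S Δ) :
    parse x.encode = [x.factList.map fun f => encodeNat f.1 :: List.ofFn f.2,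
      x.factList.map fun f => [x.factList.map fun g => decide (x.inst.prior f g)]] := by
  unfold parse FDCCatInput.encode encRelation
  simp only [List.foldr_append, List.foldr_cons]
  rw [parse_flatMap fun f items => parse_encRow _ items _, parse_blank,
    parse_flatMap fun f items => parse_encFact f items _]
  rfl

/-- The decision procedure for c-categoricity. -/
def decideCCat (w : List Γ') : Bool :=
  isCategorical (((parse w).getD 2 []).map fun r => r.headD [])
    (((parse w).getD 3 []).map fun r => r.headD [])

theorem encodeNat_injective : Injective encodeNat := fun a b h => by
  rw [← decode_encodeNat a, h, decode_encodeNat]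

/-- Whether two facts, given by lists of words, violate a functional dependency. -/
noncomputable def violates {S : RelSignature} (d : FD S) (u v : List (List Bool)) : Bool :=
  (u.getD 0 [] == encodeNat d.rel && v.getD 0 [] == encodeNat d.rel) &&
    ((d.lhs.toList.all fun i => u.getD (i + 1) [] == v.getD (i + 1) []) &&
      d.rhs.toList.any fun i => !(u.getD (i + 1) [] == v.getD (i + 1) []))

/-- The incidence vectors of the conflicts between facts, given by lists of words. -/
noncomputable def conflictRows {S : RelSignature} (L : List (FD S)) (us : List (List (List Bool))) :
    List (List Bool) :=
  (List.range us.length).flatMap fun i =>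
    ((List.range us.length).filter fun j =>
      L.any fun d => violates d (us.getD i []) (us.getD j [])).map fun j =>
        (List.range us.length).map fun k => k == i || k == j

/-- The decision procedure for c-categoricity with a fixed set of functional dependencies. -/
noncomputable def decideFDCCat {S : RelSignature} (L : List (FD S)) (w : List Γ') : Bool :=
  isCategorical (conflictRows L ((parse w).getD 0 []))
    (((parse w).getD 1 []).map fun r => r.headD [])

theorem cell_map_map {F : Type} {fs : List F} {φ : F → F → Bool} {i j : ℕ} (hi : i < fs.length)
    (hj : j < fs.length) : cell (fs.map fun f => fs.map (φ f)) i j = φ fs[i] fs[j] := by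
  simp [cell, List.getD_eq_getElem?_getD, hi, hj]

theorem CCatInput.decideCCat_encode (x : CCatInput) : decideCCat x.encode = x.answer := by
  classical
  obtain ⟨b₁, b₂, h⟩ := x.parse_encode
  have hrow : ∀ e, IsRow x.factList e (x.factList.map fun f => decide (f ∈ e)) := fun e i hi => by
    simp [List.getD_eq_getElem?_getD, hi]
  rw [decideCCat, h, CCatInput.answer, Bool.eq_iff_iff, decide_eq_true_iff]
  simp only [List.getD_cons_succ, List.getD_cons_zero, List.map_map]
  refine isCategorical_iff x.mem_factList x.factList_nodup ?_ ?_ (by simp) ?_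
  · intro r hr
    obtain ⟨e, he, rfl⟩ := List.mem_map.1 hr
    exact ⟨e, (x.mem_edgeList e).1 he, by
      simp only [comp_apply, List.headD_cons]
      convert hrow e⟩
  · intro e he
    exact ⟨_, List.mem_map.2 ⟨e, (x.mem_edgeList e).2 he, rfl⟩, by
      simp only [comp_apply, List.headD_cons]
      convert hrow e⟩
  · intro i j hi hj
    refine (Bool.eq_iff_iff.1 (cell_map_map
      (φ := fun f g => decide (x.inst.prior f g)) hi hj)).trans ?_
    rw [decide_eq_true_iff]

theorem violates_iff {S : RelSignature} (d : FD S) (f g : DBFact S) :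
    violates d (encodeNat f.1 :: List.ofFn f.2) (encodeNat g.1 :: List.ofFn g.2) = true ↔
      ∃ s t : Fin (S.arity d.rel) → DBConst, f = ⟨d.rel, s⟩ ∧ g = ⟨d.rel, t⟩ ∧
        (∀ i ∈ d.lhs, s i = t i) ∧ ∃ i ∈ d.rhs, s i ≠ t i := by
  -- Positions are shifted by one because the relation number comes first.
  have hget : ∀ (s : Fin (S.arity d.rel) → DBConst) (i : Fin (S.arity d.rel)) (a : List Bool),
      (a :: List.ofFn s).getD (i + 1) [] = s i := by
    intro s i a
    simp [List.getD_eq_getElem?_getD]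
  unfold violates
  simp only [List.getD_cons_zero, Bool.and_eq_true, beq_iff_eq, encodeNat_injective.eq_iff]
  constructor
  · obtain ⟨R, s⟩ := f
    obtain ⟨R', t⟩ := g
    rintro ⟨⟨h1, h2⟩, h3, h4⟩
    obtain rfl : R = d.rel := Fin.ext h1
    obtain rfl : R' = d.rel := Fin.ext h2
    simp only [hget, List.all_eq_true, List.any_eq_true, Finset.mem_toList, beq_iff_eq,
      Bool.not_eq_true', beq_eq_false_iff_ne] at h3 h4
    exact ⟨s, t, rfl, rfl, h3, h4⟩
  · rintro ⟨s, t, rfl, rfl, h3, h4⟩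
    simp only [hget, List.all_eq_true, List.any_eq_true, Finset.mem_toList, beq_iff_eq,
      Bool.not_eq_true', beq_eq_false_iff_ne]
    exact ⟨⟨trivial, trivial⟩, h3, h4⟩

-- The two tuples of a violation cannot come from the same fact, and violation is symmetric, so they
-- may be taken to be `f` and `g` in this order.
open Classical in
theorem not_satisfied_pair_iff {S : RelSignature} (d : FD S) (f g : DBFact S) :
    ¬ d.Satisfied {f, g} ↔
      violates d (encodeNat f.1 :: List.ofFn f.2) (encodeNat g.1 :: List.ofFn g.2) = true := by
  rw [violates_iff]
  unfold FD.Satisfied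
  push Not
  constructor
  · rintro ⟨s, t, hs, ht, h1, i, hi, h2⟩
    simp only [Finset.mem_insert, Finset.mem_singleton] at hs ht
    have hst : ∀ {s t : Fin (S.arity d.rel) → DBConst} {f : DBFact S},
        (⟨d.rel, s⟩ : DBFact S) = f → (⟨d.rel, t⟩ : DBFact S) = f → s = t := by
      rintro s t f rfl h
      simpa using h.symm
    rcases hs with hs | hs <;> rcases ht with ht | ht
    · exact (h2 (congrFun (hst hs ht) i)).elim
    · exact ⟨s, t, hs.symm, ht.symm, h1, i, hi, h2⟩
    · exact ⟨t, s, ht.symm, hs.symm, fun i hi => (h1 i hi).symm, i, hi, h2.symm⟩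
    · exact (h2 (congrFun (hst hs ht) i)).elim
  · rintro ⟨s, t, rfl, rfl, h1, i, hi, h2⟩
    exact ⟨s, t, by simp, by simp, h1, i, hi, h2⟩

theorem FDCCatInput.decideFDCCat_encode {S : RelSignature} {Δ : Set (FD S)} {L : List (FD S)}
    (hL : ∀ d, d ∈ L ↔ d ∈ Δ) (x : FDCCatInput S Δ) : decideFDCCat L x.encode = x.answer := by
  classical
  rw [decideFDCCat, x.parse_encode, FDCCatInput.answer, Bool.eq_iff_iff, decide_eq_true_iff]
  simp only [List.getD_cons_succ, List.getD_cons_zero, List.map_map]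
  have hget : ∀ i (hi : i < x.factList.length),
      (x.factList.map fun f => encodeNat f.1 :: List.ofFn f.2).getD i [] =
        encodeNat x.factList[i].1 :: List.ofFn x.factList[i].2 := fun i hi => by
    simp [List.getD_eq_getElem?_getD, hi]
  have hmem : ∀ r, r ∈ conflictRows L (x.factList.map fun f => encodeNat f.1 :: List.ofFn f.2) ↔
      ∃ i, ∃ hi : i < x.factList.length, ∃ j, ∃ hj : j < x.factList.length,
        (∃ d ∈ Δ, ¬ d.Satisfied {x.factList[i], x.factList[j]}) ∧
        r = (List.range x.factList.length).map fun k => k == i || k == j := by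
    intro r
    unfold conflictRows
    simp only [List.mem_flatMap, List.mem_map, List.mem_filter, List.mem_range, List.length_map,
      List.any_eq_true]
    constructor
    · rintro ⟨i, hi, j, ⟨hj, d, hd, h⟩, rfl⟩
      rw [hget i hi, hget j hj, ← not_satisfied_pair_iff] at h
      exact ⟨i, hi, j, hj, ⟨d, (hL d).1 hd, by convert h⟩, rfl⟩
    · rintro ⟨i, hi, j, hj, ⟨d, hd, h⟩, rfl⟩
      refine ⟨i, hi, j, ⟨hj, d, (hL d).2 hd, ?_⟩, rfl⟩
      rw [hget i hi, hget j hj, ← not_satisfied_pair_iff]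
      convert h
  have hrow : ∀ i (hi : i < x.factList.length) j (hj : j < x.factList.length),
      IsRow x.factList {x.factList[i], x.factList[j]}
        ((List.range x.factList.length).map fun k => k == i || k == j) := by
    intro i hi j hj k hk
    rw [getD_map_range _ hk]
    -- Without repetitions, equality of facts is equality of indices.
    simp [x.factList_nodup.getElem_inj_iff]
  refine isCategorical_iff x.mem_factList x.factList_nodup ?_ ?_ (by simp) ?_
  · intro r hr
    obtain ⟨i, hi, j, hj, hd, rfl⟩ := (hmem r).1 hr
    refine ⟨_, ?_, hrow i hi j hj⟩
    rw [x.edges_eq]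
    refine ⟨_, (x.mem_factList _).1 (List.getElem_mem hi), _,
      (x.mem_factList _).1 (List.getElem_mem hj), by congr, by convert hd⟩
  · intro e he
    rw [x.edges_eq] at he
    obtain ⟨f, hf, g, hg, rfl, hd⟩ := he
    obtain ⟨i, hi, rfl⟩ := List.getElem_of_mem ((x.mem_factList f).2 hf)
    obtain ⟨j, hj, rfl⟩ := List.getElem_of_mem ((x.mem_factList g).2 hg)
    exact ⟨_, (hmem _).2 ⟨i, hi, j, hj, by convert hd, rfl⟩, by convert hrow i hi j hj⟩
  · intro i j hi hj
    refine (Bool.eq_iff_iff.1 (cell_map_map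
      (φ := fun f g => decide (x.inst.prior f g)) hi hj)).trans ?_
    rw [decide_eq_true_iff]

/-- Makes every `Δ` finite, so that it can be built into the program as a list. -/
instance (S : RelSignature) : Finite (FD S) :=
  Finite.of_injective (β := Σ R : Fin S.numRel, Finset (Fin (S.arity R)) × Finset (Fin (S.arity R)))
    (fun d => ⟨d.rel, d.lhs, d.rhs⟩) fun ⟨R, X, Y⟩ ⟨R', X', Y'⟩ h => by
      obtain ⟨rfl, h⟩ := Sigma.mk.inj h
      obtain ⟨rfl, rfl⟩ := Prod.mk.inj (eq_of_heq h)
      rfl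

namespace PolyTime

open Enc

variable {γ : Type} [Enc γ]

theorem parseStep {a : γ → Γ'} {s : γ → ParserState} (ha : PolyTime a) (hs : PolyTime s) :
    PolyTime fun x => parseStep (a x) (s x) :=
  (ha.symbol_beq _).cond (pair (pair (cons (const _) hs.fst.fst) hs.fst.snd) hs.snd) <|
  (ha.symbol_beq _).cond (pair (pair (cons (const _) hs.fst.fst) hs.fst.snd) hs.snd) <|
  (ha.symbol_beq _).cond (pair (pair (const _) (cons hs.fst.fst hs.fst.snd)) hs.snd) <|
  (ha.symbol_beq _).cond (pair (const _)
    (pair (cons (cons hs.fst.fst hs.fst.snd) hs.snd.fst) hs.snd.snd)) <|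
  (ha.symbol_beq _).cond (pair hs.fst (pair (const _) (cons hs.snd.fst hs.snd.snd))) hs

theorem parse {w : γ → List Γ'} (hw : PolyTime w) : PolyTime fun x => parse (w x) := by
  -- Words and items are moved, never copied, so each symbol enlarges the state by at most a
  -- constant.
  have := foldr_of_growth (s := fun _ => parsed [] []) (g := fun _ => _root_.parseStep) hw
    (const _) (parseStep id.snd id.fst.snd) (.const 10) fun c s a _ => by
      obtain ⟨⟨u, f⟩, b, bs⟩ := s
      rcases a with _ | ⟨_ | _⟩ | _ | _ | _ <;>
        simp only [parseStep_bit, parseStep_comma, parseStep_bra, parseStep_ket, parseStep_blank,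
          size_prod, size_cons, size_nil] <;>
        have := size_bool_le true <;> have := size_bool_le false <;> omega
  exact cons this.snd.fst this.snd.snd

theorem heads {l : γ → List (List (List Bool))} (hl : PolyTime l) :
    PolyTime fun x => (l x).map fun r => r.headD [] :=
  map hl (headD id.snd [])

theorem decideCCat : PolyTime decideCCat :=
  isCategorical (heads (getD (parse id) (const 2) [])) (heads (getD (parse id) (const 3) []))

theorem violates {S : RelSignature} (d : FD S) {u v : γ → List (List Bool)} (hu : PolyTime u)
    (hv : PolyTime v) : PolyTime fun x => violates d (u x) (v x) :=
  have h (i : ℕ) : PolyTime fun x => (u x).getD i [] == (v x).getD i [] :=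
    list_beq (hu.getD (const i) []) (hv.getD (const i) [])
  and (and (list_beq (hu.getD (const 0) []) (const _)) (list_beq (hv.getD (const 0) []) (const _)))
    (and (all_const _ fun i => h (i + 1)) (any_const _ fun i => not (h (i + 1))))

theorem conflictRows {S : RelSignature} (L : List (FD S)) {u : γ → List (List (List Bool))}
    (hu : PolyTime u) : PolyTime fun x => conflictRows L (u x) :=
  flatMap hu.length.range (map (filter (hu.length.range.comp id.fst)
    (any_const L fun d => violates d (getD (hu.comp id.fst.fst) id.fst.snd [])
      (getD (hu.comp id.fst.fst) id.snd [])))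
    (map (hu.length.range.comp id.fst.fst) (or (nat_beq id.snd id.fst.fst.snd)
      (nat_beq id.snd id.fst.snd))))

theorem decideFDCCat {S : RelSignature} (L : List (FD S)) : PolyTime (decideFDCCat L) :=
  isCategorical (conflictRows L (getD (parse id) (const 0) []))
    (heads (getD (parse id) (const 1) []))

end PolyTime

end

/-- c-categoricity is solvable in polynomial time, for inputs with constraints given as a conflict
hypergraph, and (in data complexity) for every fixed set of functional dependencies. -/
theorem mainTheorem2 :
    SolvableInPolyTime CCatInput.encode CCatInput.answer ∧
      ∀ (S : RelSignature) (Δ : Set (FD S)),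
        SolvableInPolyTime (FDCCatInput.encode (S := S) (Δ := Δ)) FDCCatInput.answer := by
  refine ⟨PolyTime.decideCCat.solvableInPolyTime CCatInput.decideCCat_encode, fun S Δ => ?_⟩
  exact (PolyTime.decideFDCCat (Set.toFinite Δ).toFinset.toList).solvableInPolyTime
    (FDCCatInput.decideFDCCat_encode fun d => by simp)
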